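/- **Definitions.** PPT means probabilistic polynomial time (in the length of the input). $U_\ell$ is the uniform distribution on $\{0,1\}^\ell$, and $L_n=L\cap\{0,1\}^n$. Let $\epsilon_c,\epsilon_s,\epsilon_z:\mathbb N\to[0,1]$ and let $L\in\mathsf{NP}$ with an NP relation $\mathcal R_L$. An $(\epsilon_c,\epsilon_s,\epsilon_z)$-NIZK proof for $L$ *with randomized verification* consists of a PPT algorithm $\mathsf{Gen}$, a (computationally unbounded, randomized) prover $\mathsf P$ and a PPT verifier $\mathsf V$ such that * *Completeness:* for all $n$, $x\in L_n$ and $w$ with $(x,w)\in\mathcal R_L$, $\Pr[\mathsf V(x;r,\pi)=1]\ge 1-\epsilon_c(n)$, where $r\leftarrow\mathsf{Gen}(1^n)$, $\pi\leftarrow\mathsf P(x,w;r)$, and the probability is also over the coins of $\mathsf V$. * *Soundness:* for all $n$, $x\in\{0,1\}^n\setminus L_n$ and every prover $\mathsf P^*$, $\Pr[\mathsf V(x;r,\pi)=1]\le\epsilon_s(n)$, where $r\leftarrow\mathsf{Gen}(1^n)$, $\pi\leftarrow\mathsf P^*(x;r)$. * *Computational zero-knowledge:* there is a PPT simulator $\mathsf{Sim}$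 such that for every non-uniform PPT distinguisher $D$ and all large enough $n$, for all $x\in L_n$ and $(x,w)\in\mathcal R_L$, $|\Pr[D(\mathsf{Sim}(x))=1]-\Pr[D(r,\pi)=1]|\le\epsilon_z(n)$, where $r\leftarrow\mathsf{Gen}(1^n)$, $\pi\leftarrow\mathsf P(x,w;r)$. An NIZK *argument* is the same, except that $\mathsf P$ must be PPT and soundness is required only against PPT provers $\mathsf P^*$ (for each of them, for all large enough $n$). Let $\mathcal F=\{f_x:\{0,1\}^{m_1(|x|)}\to\{0,1\}^{m_2(|x|)}\}_{x\in\{0,1\}^*}$ be a function family, with polynomials $m_1,m_2$. An algorithm $\mathcal A$ *distributionally inverts $f_x$ with deviation at most $\delta$* if, for $z\leftarrow U_{m_1(|x|)}$, the statistical distance between $(z,f_x(z))$ and $(\mathcal A(x,f_x(z)),f_x(z))$ is at most $\delta$. **Lemma.** Let $\epsilon_c, \epsilon_s, \epsilon_z: \mathbb N \to [0,1]$ and suppose that a language $L\in\mathsf{NP}$ has an $(\epsilon_c,\epsilon_s,\epsilon_z)$-NIZK proof or argument with randomized verification. Then for every polynomial $p$ (positive at all large enough $n$) there exist a reduction $R$,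 which is a (probabilistic) polynomial-time oracle-aided algorithm, and a polynomial-time computable function family $\mathcal F=\{f_x\}_{x\in\{0,1\}^*}$ such that for every PPT algorithm $\mathcal A$ there is a negligible function $\mathrm{negl}$ such that for all large enough $n$: 1. for every $x\in L_n$, if $\mathcal A$ distributionally inverts $f_x$ with deviation at most $1/p(n)$, then $$\Pr[R^{\mathcal A}(x)=1]\ \ge\ 1-\epsilon_c(n)-\epsilon_z(n)-\frac{3}{p(n)}-\mathrm{negl}(n);$$ 2. for every $x\in\{0,1\}^n\setminus L_n$, $$\Pr[R^{\mathcal A}(x)=1]\ \le\ \epsilon_s(n).$$ Here the queries of $R^{\mathcal A}$ are answered by $\mathcal A$ with fresh independent coins. -/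

import Mathlib

open Filter

namespace NIZK

/-! ## Data and programs

Algorithms are programs over finite binary trees whose leaves are bits or the empty list
(the data type of S-expressions).  Bit strings and tuples of bit strings are encoded as such trees
by `ofBits` and `Data.pair`. -/

inductive Data : Type
  | nil : Data
  | bit (b : Bool) : Data
  | pair (a b : Data) : Data
  deriving DecidableEq

namespace Data

/-- The number of nodes. -/
def size : Data → ℕ
  | nil => 1
  | bit _ => 1
  | pair a b => a.size + b.size + 1

def fst : Data → Data
  | pair a _ => a
  | _ => nil

def snd : Data → Data
  | pair _ b => b
  | _ => nil

def isPair : Data → Bool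
  | pair _ _ => true
  | _ => false

/-- The encoding of a bit string of length `l` has size `2 * l + 1`. -/
def ofBits : List Bool → Data
  | [] => nil
  | b :: l => pair (bit b) (ofBits l)

/-- Every tree is read as a bit string; this is a left inverse of `ofBits`. -/
def toBits : Data → List Bool
  | pair a b => decide (a = bit true) :: toBits b
  | _ => []

theorem toBits_ofBits (l : List Bool) : toBits (ofBits l) = l := by
  induction l with
  | nil => rfl
  | cons b l ih => cases b <;> simp [ofBits, toBits, ih]

theorem size_ofBits (l : List Bool) : (ofBits l).size = 2 * l.length + 1 := by
  induction l with
  | nil => rfl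
  | cons b l ih => simp only [ofBits, size, ih, List.length_cons]; ring

end Data

open Data

/-- While-programs in combinator form, with a query instruction to an oracle. A program maps a tree
`v` to a tree. -/
inductive Code : Type
  /-- `v ↦ v` -/
  | id : Code
  /-- `v ↦ d` -/
  | const (d : Data) : Code
  /-- `(a, b) ↦ a` -/
  | fst : Code
  /-- `(a, b) ↦ b` -/
  | snd : Code
  /-- tests whether `v` is a pair -/
  | isPair : Code
  /-- `(a, b) ↦` the bit saying whether `a = b` -/
  | eq : Code
  /-- `v ↦ (f v, g v)` -/
  | pair (f g : Code) : Code
  /-- `v ↦ g (f v)` -/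
  | comp (g f : Code) : Code
  /-- `v ↦ f v` if `c v` is the bit `1`, and `v ↦ g v` otherwise -/
  | cond (c f g : Code) : Code
  /-- while `c v` is the bit `1`, replace `v` by `f v` -/
  | loop (c f : Code) : Code
  /-- `(a, u) ↦` the first `u.size` bits of the oracle's answer to the query `a` -/
  | query : Code

section Semantics

variable {m : Type → Type} [Monad m]

/-- Charge `n` more steps. -/
def tick (n : ℕ) (a : m (Option (Data × ℕ))) : m (Option (Data × ℕ)) :=
  a >>= fun o => pure (o.map fun r => (r.1, n + r.2))

/-- Run `a`, then `f` on its result; the numbers of steps add up. -/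
def andThen (a : m (Option (Data × ℕ))) (f : Data → m (Option (Data × ℕ))) :
    m (Option (Data × ℕ)) :=
  a >>= fun o => match o with
    | none => pure none
    | some r => tick r.2 (f r.1)

/-- The while loop, given up (`none`) when it has not ended after `k` tests of its condition. -/
def whileLoop (c f : Data → m (Option (Data × ℕ))) : ℕ → Data → m (Option (Data × ℕ))
  | 0, _ => pure none
  | k + 1, v => tick v.size (andThen (c v) fun b =>
      if b = bit true then andThen (f v) (whileLoop c f k) else pure (some (v, 0)))

/-- Execution of a program with oracle `O`. The result `some (d, t)` means that the program halts
with output `d` after `t` steps. Evaluating a node of the program on `v` costs `v.size` steps, in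
addition to the steps of its parts; so also the size of the output is bounded by a constant multiple
of the number of steps, the constant depending on the program only. `none` means that some loop was
given up after `k` rounds. As every round costs at least one step, a program that halts within `k`
steps is never given up.

The monad `m` is `Id` for deterministic oracles and `PMF` for randomized ones; in the latter
case each query is answered with fresh independent randomness. -/
def Code.exec (O : Data → m (List Bool)) (k : ℕ) : Code → Data → m (Option (Data × ℕ))
  | .id, v => pure (some (v, v.size))
  | .const d, v => pure (some (d, v.size))
  | .fst, v => pure (some (v.fst, v.size))
  | .snd, v => pure (some (v.snd, v.size))
  | .isPair, v => pure (some (bit v.isPair, v.size))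
  | .eq, v => pure (some (bit (decide (v.fst = v.snd)), v.size))
  | .pair f g, v => tick v.size (andThen (f.exec O k v) fun a =>
      andThen (g.exec O k v) fun b => pure (some (Data.pair a b, 0)))
  | .comp g f, v => tick v.size (andThen (f.exec O k v) (g.exec O k))
  | .cond c f g, v => tick v.size (andThen (c.exec O k v) fun b =>
      if b = bit true then f.exec O k v else g.exec O k v)
  | .loop c f, v => whileLoop (c.exec O k) (f.exec O k) k v
  | .query, v => O v.fst >>= fun y => pure (some (ofBits (y.take v.snd.size), v.size))

end Semantics

/-! ## Polynomial-time algorithms -/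

/-- Execution without an oracle (queries are answered by the empty string). -/
def Code.exec₀ (k : ℕ) (c : Code) (v : Data) : Option (Data × ℕ) :=
  Id.run (c.exec (m := Id) (fun _ => pure []) k v)

/-- A deterministic polynomial-time algorithm. -/
structure PolyTime where
  code : Code
  time : Polynomial ℕ
  halts : ∀ v : Data, ∃ d t, code.exec₀ (time.eval v.size) v = some (d, t) ∧ t ≤ time.eval v.size

/-- The output of a deterministic polynomial-time algorithm. -/
def PolyTime.run (M : PolyTime) (v : Data) : Data :=
  ((M.code.exec₀ (M.time.eval v.size) v).map Prod.fst).getD nil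

/-- The uniform distribution on bit strings of length `l`. -/
noncomputable def uniformBits (l : ℕ) : PMF (List Bool) :=
  (PMF.uniformOfFintype (Fin l → Bool)).map List.ofFn

/-- A probabilistic polynomial-time (PPT) algorithm: a deterministic polynomial-time algorithm that
receives, next to its input, polynomially many uniformly random bits. -/
structure PPT extends PolyTime where
  coins : Polynomial ℕ

/-- The output distribution of a PPT algorithm. -/
noncomputable def PPT.dist (M : PPT) (v : Data) : PMF Data :=
  (uniformBits (M.coins.eval v.size)).map fun ρ => M.run (Data.pair v (ofBits ρ))

/-- The output distribution, the output being read as a bit string. -/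
noncomputable def PPT.distBits (M : PPT) (v : Data) : PMF (List Bool) :=
  (M.dist v).map toBits

/-- The output distribution, the output being read as a pair of bit strings. -/
noncomputable def PPT.distPair (M : PPT) (v : Data) : PMF (List Bool × List Bool) :=
  (M.dist v).map fun d => (toBits d.fst, toBits d.snd)

/-- The distribution of the decision of a PPT algorithm: it accepts by the output `1`. -/
noncomputable def PPT.decision (M : PPT) (v : Data) : PMF Bool :=
  (M.dist v).map fun d => decide (d = bit true)

/-- A probabilistic polynomial-time oracle-aided algorithm. It halts in polynomial time whatever
the oracle, the coins and the answers are; a query counts as one operation. -/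
structure OraclePPT where
  code : Code
  time : Polynomial ℕ
  coins : Polynomial ℕ
  halts : ∀ (O : Data → PMF (List Bool)) (v : Data),
    ∀ o ∈ (code.exec O (time.eval v.size) v).support, ∃ d t, o = some (d, t) ∧ t ≤ time.eval v.size

/-- The probability, over the coins of `R` and the randomness of the oracle's answers, that `R`
with oracle `O` outputs `1` on `v`. -/
noncomputable def OraclePPT.acceptProb (R : OraclePPT) (O : Data → PMF (List Bool)) (v : Data) :
    ℝ :=
  (((uniformBits (R.coins.eval v.size)).bind fun ρ =>
    (R.code.exec O (R.time.eval (Data.pair v (ofBits ρ)).size) (Data.pair v (ofBits ρ))).map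
      fun o => decide (o.map Prod.fst = some (bit true))) true).toReal

/-- `Rel` is an NP relation for the language `L`: it is decidable in deterministic polynomial time,
witnesses have polynomially bounded length, and `L` consists of the strings that have a witness. -/
def IsNPRelation (L : Set (List Bool)) (Rel : List Bool → List Bool → Prop) : Prop :=
  (∃ M : PolyTime, ∀ x w, Rel x w ↔ M.run (Data.pair (ofBits x) (ofBits w)) = bit true) ∧
  (∃ q : Polynomial ℕ, ∀ x w, Rel x w → w.length ≤ q.eval x.length) ∧
  ∀ x, x ∈ L ↔ ∃ w, Rel x w

/-! ## Non-interactive zero-knowledge -/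

/-- The common reference string sampled by `Gen` on input `1ⁿ`. -/
noncomputable def crs (Gen : PPT) (n : ℕ) : PMF (List Bool) :=
  Gen.distBits (ofBits (List.replicate n true))

/-- The decision of the randomized verifier on `(x; r, π)`. -/
noncomputable def verdict (V : PPT) (x r π : List Bool) : PMF Bool :=
  V.decision (Data.pair (ofBits x) (Data.pair (ofBits r) (ofBits π)))

/-- The distribution of `(r, π)`, where `r` is the common reference string and `π` is sampled by the
prover strategy `S` on `r`. -/
noncomputable def transcript (Gen : PPT) (n : ℕ) (S : List Bool → PMF (List Bool)) :
    PMF (List Bool × List Bool) :=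
  (crs Gen n).bind fun r => (S r).map fun π => (r, π)

/-- The probability that the verifier accepts `x` when the prover strategy is `S`. -/
noncomputable def acceptProb (Gen V : PPT) (x : List Bool) (S : List Bool → PMF (List Bool)) : ℝ :=
  (((transcript Gen x.length S).bind fun t => verdict V x t.1 t.2) true).toReal

/-- An honest prover: the distribution of the message `π` on input `(x, w; r)`. -/
abbrev Prover := List Bool → List Bool → List Bool → PMF (List Bool)

/-- The prover computed by a PPT algorithm. -/
noncomputable def PPT.prover (P : PPT) : Prover := fun x w r =>
  P.distBits (Data.pair (ofBits x) (Data.pair (ofBits w) (ofBits r)))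

/-- The malicious prover computed by a PPT algorithm from the input `(x; r)`. -/
noncomputable def PPT.cheat (P : PPT) (x r : List Bool) : PMF (List Bool) :=
  P.distBits (Data.pair (ofBits x) (ofBits r))

def Complete (Rel : List Bool → List Bool → Prop) (εc : ℕ → ℝ) (Gen V : PPT) (P : Prover) : Prop :=
  ∀ x w, Rel x w → 1 - εc x.length ≤ acceptProb Gen V x (P x w)

/-- Soundness against all provers. -/
def Sound (L : Set (List Bool)) (εs : ℕ → ℝ) (Gen V : PPT) : Prop :=
  ∀ x, x ∉ L → ∀ S : List Bool → PMF (List Bool), acceptProb Gen V x S ≤ εs x.length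

/-- Soundness against PPT provers, for all large enough input lengths. -/
def CompSound (L : Set (List Bool)) (εs : ℕ → ℝ) (Gen V : PPT) : Prop :=
  ∀ S : PPT, ∀ᶠ n : ℕ in atTop, ∀ x, x.length = n → x ∉ L → acceptProb Gen V x (S.cheat x) ≤ εs n

/-- A non-uniform PPT algorithm deciding pairs of strings: a PPT algorithm together with an advice
string of polynomial length for each `n`. -/
structure Distinguisher where
  alg : PPT
  advice : ℕ → List Bool
  bound : Polynomial ℕ
  advice_le : ∀ n, (advice n).length ≤ bound.eval n

/-- The probability that the distinguisher outputs `1` on a sample of `X`. -/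
noncomputable def Distinguisher.prob (D : Distinguisher) (n : ℕ) (X : PMF (List Bool × List Bool)) :
    ℝ :=
  ((X.bind fun t => D.alg.decision
    (Data.pair (ofBits (D.advice n)) (Data.pair (ofBits t.1) (ofBits t.2)))) true).toReal

/-- Computational zero-knowledge: some PPT simulator is, up to advantage `εz`, indistinguishable
from the verifier's view `(r, π)` by non-uniform PPT distinguishers, for all large enough `n`. -/
def ZeroKnowledge (Rel : List Bool → List Bool → Prop) (εz : ℕ → ℝ) (Gen : PPT) (P : Prover) :
    Prop :=
  ∃ Sim : PPT, ∀ D : Distinguisher, ∀ᶠ n : ℕ in atTop, ∀ x w, x.length = n → Rel x w →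
    |D.prob n (Sim.distPair (ofBits x)) - D.prob n (transcript Gen n (P x w))| ≤ εz n

/-- `L` has an `(εc, εs, εz)`-NIZK proof, with randomized verification. -/
def HasNIZKProof (L : Set (List Bool)) (Rel : List Bool → List Bool → Prop) (εc εs εz : ℕ → ℝ) :
    Prop :=
  ∃ (Gen V : PPT) (P : Prover),
    Complete Rel εc Gen V P ∧ Sound L εs Gen V ∧ ZeroKnowledge Rel εz Gen P

/-- `L` has an `(εc, εs, εz)`-NIZK argument, with randomized verification. -/
def HasNIZKArgument (L : Set (List Bool)) (Rel : List Bool → List Bool → Prop)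
    (εc εs εz : ℕ → ℝ) : Prop :=
  ∃ Gen V P : PPT,
    Complete Rel εc Gen V P.prover ∧ CompSound L εs Gen V ∧ ZeroKnowledge Rel εz Gen P.prover

/-! ## Function families and distributional inversion -/

/-- A polynomial-time computable family of functions
`f_x : {0,1}^(inLen |x|) → {0,1}^(outLen |x|)`, indexed by all bit strings `x`. -/
structure FunFamily where
  inLen : Polynomial ℕ
  outLen : Polynomial ℕ
  f : List Bool → List Bool → List Bool
  alg : PolyTime
  computes : ∀ x z, z.length = inLen.eval x.length →
    alg.run (Data.pair (ofBits x) (ofBits z)) = ofBits (f x z)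
  length_f : ∀ x z, z.length = inLen.eval x.length → (f x z).length = outLen.eval x.length

/-- Statistical distance. -/
noncomputable def statDist {α : Type*} (X Y : PMF α) : ℝ :=
  (1 / 2) * ∑' u, |(X u).toReal - (Y u).toReal|

/-- `A` distributionally inverts `f_x` with deviation at most `δ`: for uniform `z`, the statistical
distance of `(z, f_x z)` and `(A (x, f_x z), f_x z)` is at most `δ`. -/
def DistInverts (A : PPT) (F : FunFamily) (x : List Bool) (δ : ℝ) : Prop :=
  statDist
    ((uniformBits (F.inLen.eval x.length)).map fun z => (z, F.f x z))
    ((uniformBits (F.inLen.eval x.length)).bind fun z =>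
      (A.distBits (Data.pair (ofBits x) (ofBits (F.f x z)))).map fun z' => (z', F.f x z)) ≤ δ

/-- Negligible functions: eventually smaller than every inverse polynomial. -/
def Negligible (ν : ℕ → ℝ) : Prop :=
  Asymptotics.SuperpolynomialDecay atTop (fun n : ℕ => (n : ℝ)) ν

end NIZK

namespace NIZK

open Data

/-! ## Deterministic executions -/

/-! The function `f_x` sends the coins `z` of the simulator to the (padded) reference string that it
outputs on `x`. The reduction samples an honest string `r`, asks the inverter `k ≥ p(n)` times for
coins that explain `r`, and reads off the `k` simulated proofs. It estimates how often each is
accepted by `m` runs of the verifier, keeps the best one, and outputs the verifier's decision on it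
with fresh coins.

Soundness. Everything before the last verification is a prover, and it is PPT because `A` is. The
reduction accepts exactly as often as the verifier accepts this prover, so the bound `εs` is
inherited without loss.

Completeness. Passing from honest to simulated pairs and back would cost `εz` twice: once to see
that simulated proofs are accepted, once to exchange the reference string. A single comparison costs
it only once. Given `(r, π)`, the distinguisher runs the same selection on `r` and reports whether
`π` is accepted in strictly more of `m` runs than the best candidate. If `(r, π)` is simulated and
the inverter is perfect, then `π` and the candidates are independent and identically distributed
given `r`, so this happens with probability at most `1/(k+1)` (`ex_beats_le`). The deviation of the
inverter adds `1/p` (`advantage_sim_le`), and zero-knowledge adds `εz` for honest pairs. When the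
honest proof does not win, the winner has at least as many successes. A largest count is biased
upwards, but on average by at most `k * s` when `m = s ^ 2` (`ex_best_count_le`), hence by `k / s`
in probability, and `s = (k+1) ^ 2` makes this at most `1/(k+1)`. Thus the honest acceptance
probability, at least `1 - εc`, exceeds that of the reduction by at most `εz + 2/(k+1) + 1/p ≤ εz +
3/p` (`accept_le_successProb`).

Most of the rest shows that these algorithms are programs of the given model. `Poly` is a calculus
of typed polynomial-time functions, `Samples` turns coin strings into exact samples of the intended
distributions, and `exists_oraclePPT` assembles programs with queries. Since all sampling is exact,
the negligible term can be zero. -/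

theorem Data.size_pos (v : Data) : 1 ≤ v.size := by
  cases v <;> simp [Data.size]

/-- `c` halts on `v` with output `d` after exactly `t` steps. -/
def Runs (c : Code) (v d : Data) (t : ℕ) : Prop :=
  ∀ k, t ≤ k → c.exec₀ k v = some (d, t)

/-- The loop with condition `c` and body `f` halts on `v` with output `d` after `t` steps. -/
def LoopRuns (c f : Code) (v d : Data) (t : ℕ) : Prop :=
  ∀ k, t ≤ k → ∀ j, t ≤ j → whileLoop (m := Id) (c.exec₀ k) (f.exec₀ k) j v = some (d, t)

theorem andThen_some (r : Data × ℕ) (f : Data → Id (Option (Data × ℕ))) :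
    andThen (m := Id) (some r) f = tick r.2 (f r.1) := rfl

theorem andThen_id {a : Id (Option (Data × ℕ))} {f : Data → Id (Option (Data × ℕ))} {r : Data × ℕ}
    (h : andThen a f = some r) :
    ∃ p q : Data × ℕ, a = some p ∧ f p.1 = some q ∧ r = (q.1, p.2 + q.2) := by
  rcases a with _ | p
  · cases h
  · obtain ⟨q, hq, rfl⟩ := Option.map_eq_some_iff.1 h
    exact ⟨p, q, rfl, hq, rfl⟩

theorem tick_id {n : ℕ} {a : Id (Option (Data × ℕ))} {r : Data × ℕ}
    (h : tick n a = some r) : ∃ p : Data × ℕ, a = some p ∧ r = (p.1, n + p.2) := by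
  obtain ⟨q, hq, rfl⟩ := Option.map_eq_some_iff.1 h
  exact ⟨q, hq, rfl⟩

theorem exec₀_pair (f g : Code) (k : ℕ) (v : Data) : (Code.pair f g).exec₀ k v =
    tick (m := Id) v.size (andThen (f.exec₀ k v) fun a =>
      andThen (g.exec₀ k v) fun b => some (Data.pair a b, 0)) := rfl

theorem exec₀_comp (f g : Code) (k : ℕ) (v : Data) : (Code.comp g f).exec₀ k v =
    tick (m := Id) v.size (andThen (f.exec₀ k v) (g.exec₀ k)) := rfl

theorem exec₀_cond (c f g : Code) (k : ℕ) (v : Data) : (Code.cond c f g).exec₀ k v =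
    tick (m := Id) v.size (andThen (c.exec₀ k v) fun b =>
      if b = bit true then f.exec₀ k v else g.exec₀ k v) := rfl

theorem exec₀_loop (c f : Code) (k : ℕ) (v : Data) : (Code.loop c f).exec₀ k v =
    whileLoop (m := Id) (c.exec₀ k) (f.exec₀ k) k v := rfl

theorem whileLoop_succ (c f : Data → Option (Data × ℕ)) (k : ℕ) (v : Data) :
    whileLoop (m := Id) c f (k + 1) v = tick (m := Id) v.size (andThen (c v) fun b =>
      if b = bit true then andThen (f v) (whileLoop (m := Id) c f k) else some (v, 0)) := rfl

theorem Runs.pair {f g : Code} {v a b : Data} {s t : ℕ} (hf : Runs f v a s) (hg : Runs g v b t) :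
    Runs (.pair f g) v (.pair a b) (v.size + (s + t)) := by
  intro k hk
  rw [exec₀_pair, hf k (by omega), hg k (by omega)]
  rfl

theorem Runs.comp {f g : Code} {v a b : Data} {s t : ℕ} (hf : Runs f v a s) (hg : Runs g a b t) :
    Runs (.comp g f) v b (v.size + (s + t)) := by
  intro k hk
  rw [exec₀_comp, hf k (by omega), andThen_some, hg k (by omega)]
  rfl

theorem Runs.cond_true {c f g : Code} {v b : Data} {s t : ℕ} (hc : Runs c v (bit true) s)
    (hf : Runs f v b t) : Runs (.cond c f g) v b (v.size + (s + t)) := by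
  intro k hk
  rw [exec₀_cond, hc k (by omega), andThen_some, if_pos rfl, hf k (by omega)]
  rfl

theorem Runs.cond_false {c f g : Code} {v b e : Data} {s t : ℕ} (hc : Runs c v e s)
    (he : e ≠ bit true) (hg : Runs g v b t) : Runs (.cond c f g) v b (v.size + (s + t)) := by
  intro k hk
  rw [exec₀_cond, hc k (by omega), andThen_some, if_neg he, hg k (by omega)]
  rfl

theorem LoopRuns.exit {c f : Code} {v b : Data} {s : ℕ} (hc : Runs c v b s) (hb : b ≠ bit true) :
    LoopRuns c f v v (v.size + s) := by
  intro k hk j hj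
  have := v.size_pos
  obtain ⟨j, rfl⟩ : ∃ i, j = i + 1 := ⟨j - 1, by omega⟩
  rw [whileLoop_succ, hc k (by omega), andThen_some, if_neg hb]
  rfl

theorem LoopRuns.step {c f : Code} {v w d : Data} {s s' t : ℕ} (hc : Runs c v (bit true) s)
    (hf : Runs f v w s') (h : LoopRuns c f w d t) : LoopRuns c f v d (v.size + (s + (s' + t))) := by
  intro k hk j hj
  have := v.size_pos
  obtain ⟨j, rfl⟩ : ∃ i, j = i + 1 := ⟨j - 1, by omega⟩
  rw [whileLoop_succ, hc k (by omega), andThen_some, if_pos rfl, hf k (by omega), andThen_some,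
    h k (by omega) j (by omega)]
  rfl

theorem LoopRuns.runs {c f : Code} {v d : Data} {t : ℕ} (h : LoopRuns c f v d t) :
    Runs (.loop c f) v d t := fun k hk => h k hk k hk

/-- A bounded execution that was not given up is a full execution. -/
theorem Runs.of_exec₀ {c : Code} {k : ℕ} {v d : Data} {t : ℕ} (h : c.exec₀ k v = some (d, t)) :
    Runs c v d t := by
  have atomic : ∀ {c : Code} {v d e : Data} {t : ℕ}, (∀ k, c.exec₀ k v = some (e, v.size)) →
      c.exec₀ k v = some (d, t) → Runs c v d t := by
    intro c v d e t hc h k' _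
    rw [hc] at h ⊢
    exact h
  induction c generalizing v d t with
  | id => exact atomic (fun _ => rfl) h
  | const e => exact atomic (fun _ => rfl) h
  | fst => exact atomic (fun _ => rfl) h
  | snd => exact atomic (fun _ => rfl) h
  | isPair => exact atomic (fun _ => rfl) h
  | eq => exact atomic (fun _ => rfl) h
  | query => exact atomic (e := nil) (fun _ => by simp [Code.exec₀, Code.exec, ofBits]) h
  | pair f g hf hg =>
    obtain ⟨p, h0, e⟩ := tick_id h
    obtain ⟨p1, q1, h1, h2, rfl⟩ := andThen_id h0
    obtain ⟨p2, q2, h3, h4, rfl⟩ := andThen_id h2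
    cases h4
    cases e
    exact (hf h1).pair (hg h3)
  | comp g f hg hf =>
    obtain ⟨p, h0, e⟩ := tick_id h
    obtain ⟨p1, q1, h1, h2, rfl⟩ := andThen_id h0
    cases e
    exact (hf h1).comp (hg h2)
  | cond c f g hc hf hg =>
    obtain ⟨p, h0, e⟩ := tick_id h
    obtain ⟨⟨b, s⟩, q1, h1, h2, rfl⟩ := andThen_id h0
    cases e
    by_cases hb : b = bit true
    · subst hb
      exact (hc h1).cond_true (hf ((if_pos rfl).symm.trans h2))
    · exact (hc h1).cond_false hb (hg ((if_neg hb).symm.trans h2))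
  | loop c f hc hf =>
    rw [exec₀_loop] at h
    -- Only the fuel `j` of the outer loop varies in the induction; the bound `k` for the condition
    -- and the body stays fixed.
    suffices ∀ j v d t, whileLoop (m := Id) (c.exec₀ k) (f.exec₀ k) j v = some (d, t) →
        LoopRuns c f v d t from (this k v d t h).runs
    intro j
    induction j with
    | zero => intro v d t h; cases h
    | succ j ih =>
      intro v d t h
      rw [whileLoop_succ] at h
      obtain ⟨p, h0, e⟩ := tick_id h
      obtain ⟨⟨b, s⟩, q1, h1, h2, rfl⟩ := andThen_id h0
      cases e
      by_cases hb : b = bit true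
      · subst hb
        obtain ⟨p2, q2, h3, h4, rfl⟩ := andThen_id ((if_pos rfl).symm.trans h2)
        exact LoopRuns.step (hc h1) (hf h3) (ih _ _ _ h4)
      · cases (if_neg hb).symm.trans h2
        exact LoopRuns.exit (hc h1) hb

/-- The size of the output is at most `c.growth` times the number of steps. -/
def Code.growth : Code → ℕ
  | .const d => d.size
  | .pair f g => f.growth + g.growth + 1
  | .comp g _ => g.growth
  | .cond _ f g => f.growth + g.growth
  | _ => 1

/-- Each node is charged the size of its input, and only constants and pairing create data, so the
output is linear in the time. For the loop the factor is `1`: its output is the argument of its last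
test, which has been charged. -/
theorem exec₀_size {c : Code} {k : ℕ} {v d : Data} {t : ℕ} (h : c.exec₀ k v = some (d, t)) :
    v.size ≤ t ∧ d.size ≤ c.growth * t := by
  have atomic : ∀ {c : Code} {v d e : Data} {t : ℕ}, c.exec₀ k v = some (e, v.size) →
      e.size ≤ c.growth * v.size →
      c.exec₀ k v = some (d, t) → v.size ≤ t ∧ d.size ≤ c.growth * t := by
    intro c v d e t hc he h
    rw [hc] at h
    cases h
    exact ⟨le_rfl, he⟩
  induction c generalizing v d t with
  | id => exact atomic rfl (by simp [Code.growth]) h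
  | const e => exact atomic rfl (Nat.le_mul_of_pos_right _ v.size_pos) h
  | fst => exact atomic rfl (by cases v <;> simp [Data.fst, Data.size, Code.growth]; omega) h
  | snd => exact atomic rfl (by cases v <;> simp [Data.snd, Data.size, Code.growth]; omega) h
  | isPair => exact atomic rfl (by simpa [Data.size, Code.growth] using v.size_pos) h
  | eq => exact atomic rfl (by simpa [Data.size, Code.growth] using v.size_pos) h
  | query =>
    exact atomic (c := .query) (v := v) (e := nil)
      (by simp [Code.exec₀, Code.exec, ofBits])
      (by simpa [Data.size, Code.growth] using v.size_pos) h
  | pair f g hf hg =>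
    obtain ⟨p, h0, e⟩ := tick_id h
    obtain ⟨p1, q1, h1, h2, rfl⟩ := andThen_id h0
    obtain ⟨p2, q2, h3, h4, rfl⟩ := andThen_id h2
    cases h4
    cases e
    have h5 := hf h1
    have h4 := hg h3
    have := v.size_pos
    simp only [Data.size, Code.growth]
    constructor
    · omega
    · have e1 : f.growth * p1.2 ≤ f.growth * (v.size + (p1.2 + (p2.2 + 0))) :=
        Nat.mul_le_mul_left _ (by omega)
      have e2 : g.growth * p2.2 ≤ g.growth * (v.size + (p1.2 + (p2.2 + 0))) :=
        Nat.mul_le_mul_left _ (by omega)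
      rw [add_mul, add_mul]
      omega
  | comp g f hg hf =>
    obtain ⟨p, h0, e⟩ := tick_id h
    obtain ⟨p1, q1, h1, h2, rfl⟩ := andThen_id h0
    cases e
    have h4 := hg h2
    simp only [Code.growth]
    exact ⟨by omega, h4.2.trans (Nat.mul_le_mul_left _ (by omega))⟩
  | cond c f g hc hf hg =>
    obtain ⟨p, h0, e⟩ := tick_id h
    obtain ⟨⟨b, s⟩, q1, h1, h2, rfl⟩ := andThen_id h0
    cases e
    refine ⟨by simp, ?_⟩
    simp only [Code.growth]
    by_cases hb : b = bit true
    · have := (hf ((if_pos hb).symm.trans h2)).2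
      refine this.trans (Nat.mul_le_mul (by omega) (by omega))
    · have := (hg ((if_neg hb).symm.trans h2)).2
      refine this.trans (Nat.mul_le_mul (by omega) (by omega))
  | loop c f hc hf =>
    rw [exec₀_loop] at h
    suffices ∀ j v d t, whileLoop (m := Id) (c.exec₀ k) (f.exec₀ k) j v = some (d, t) →
        v.size ≤ t ∧ d.size ≤ t by simpa [Code.growth] using this k v d t h
    intro j
    induction j with
    | zero => intro v d t h; cases h
    | succ j ih =>
      intro v d t h
      rw [whileLoop_succ] at h
      obtain ⟨p, h0, e⟩ := tick_id h
      obtain ⟨⟨b, s⟩, q1, h1, h2, rfl⟩ := andThen_id h0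
      cases e
      refine ⟨by simp, ?_⟩
      by_cases hb : b = bit true
      · subst hb
        obtain ⟨p2, q2, h3, h4, rfl⟩ := andThen_id ((if_pos rfl).symm.trans h2)
        have := (ih _ _ _ h4).2
        simp only
        omega
      · cases (if_neg hb).symm.trans h2
        simp

theorem Runs.size_le {c : Code} {v d : Data} {t : ℕ} (h : Runs c v d t) : d.size ≤ c.growth * t :=
  (exec₀_size (h t le_rfl)).2

/-- Replace queries by their answers in executions without oracle. -/
def Code.strip : Code → Code
  | .pair f g => .pair f.strip g.strip
  | .comp g f => .comp g.strip f.strip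
  | .cond c f g => .cond c.strip f.strip g.strip
  | .loop c f => .loop c.strip f.strip
  | .query => .const nil
  | c => c

theorem tick_pmf (n : ℕ) (o : Option (Data × ℕ)) :
    tick (m := PMF) n (pure o) = pure (tick (m := Id) n o) := by
  exact PMF.pure_bind _ _

theorem andThen_pmf (o : Option (Data × ℕ)) (f : Data → PMF (Option (Data × ℕ)))
    (g : Data → Option (Data × ℕ)) (h : ∀ v, f v = pure (g v)) :
    andThen (m := PMF) (pure o) f = pure (andThen (m := Id) o g) := by
  rcases o with _ | r
  · exact PMF.pure_bind _ _
  · refine (PMF.pure_bind _ _).trans ?_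
    change tick r.2 (f r.1) = _
    rw [h, tick_pmf]
    rfl

/-- A program without queries runs deterministically whatever the oracle. -/
theorem exec_strip (O : Data → PMF (List Bool)) (k : ℕ) (c : Code) (v : Data) :
    c.strip.exec O k v = pure (c.exec₀ k v) := by
  induction c generalizing v with
  | id => rfl
  | const e => rfl
  | fst => rfl
  | snd => rfl
  | isPair => rfl
  | eq => rfl
  | query => simp [Code.strip, Code.exec₀, Code.exec, ofBits]
  | pair f g hf hg =>
    rw [exec₀_pair, Code.strip, Code.exec, hf, andThen_pmf _ _ _ (fun a => ?_), tick_pmf]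
    rw [hg]
    exact andThen_pmf _ _ _ fun b => rfl
  | comp g f hg hf =>
    rw [exec₀_comp, Code.strip, Code.exec, hf, andThen_pmf _ _ _ hg, tick_pmf]
  | cond c f g hc hf hg =>
    rw [exec₀_cond, Code.strip, Code.exec, hc, andThen_pmf _ _ _ (fun b => ?_), tick_pmf]
    split_ifs
    · exact hf v
    · exact hg v
  | loop c f hc hf =>
    rw [exec₀_loop, Code.strip, Code.exec]
    suffices ∀ j v, whileLoop (c.strip.exec O k) (f.strip.exec O k) j v =
        pure (whileLoop (m := Id) (c.exec₀ k) (f.exec₀ k) j v) from this k v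
    intro j
    induction j with
    | zero => intro v; rfl
    | succ j ih =>
      intro v
      rw [whileLoop_succ, whileLoop, hc, andThen_pmf _ _ _ (fun b => ?_), tick_pmf]
      split_ifs
      · rw [hf]
        exact andThen_pmf _ _ _ ih
      · rfl

/-! ## Typed polynomial-time functions -/

/-- Types whose elements are encoded as trees. -/
class Enc (α : Type) where
  enc : α → Data

open Enc

instance : Enc Data := ⟨fun d => d⟩

instance : Enc Unit := ⟨fun _ => nil⟩

instance : Enc Bool := ⟨bit⟩

instance {α β : Type} [Enc α] [Enc β] : Enc (α × β) := ⟨fun p => .pair (enc p.1) (enc p.2)⟩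

/-- The encoding of lists. -/
def encList {α : Type} [Enc α] : List α → Data
  | [] => nil
  | a :: l => .pair (enc a) (encList l)

instance {α : Type} [Enc α] : Enc (List α) := ⟨encList⟩

/-- Natural numbers are encoded in unary. -/
instance : Enc ℕ := ⟨fun n => enc (List.replicate n ())⟩

/-- The size of the encoding. -/
def sz {α : Type} [Enc α] (a : α) : ℕ := (enc a).size

theorem enc_bits (l : List Bool) : enc l = ofBits l := by
  induction l with
  | nil => rfl
  | cons b l ih => exact congrArg (Data.pair (bit b)) ih

section Sizes

variable {α β : Type} [Enc α] [Enc β]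

theorem sz_pos (a : α) : 1 ≤ sz a := Data.size_pos _

theorem sz_pair (a : α) (b : β) : sz (a, b) = sz a + sz b + 1 := rfl

theorem sz_nil : sz ([] : List α) = 1 := rfl

theorem sz_cons (a : α) (l : List α) : sz (a :: l) = sz a + sz l + 1 := rfl

theorem sz_mem {a : α} {l : List α} (h : a ∈ l) : sz a + 2 ≤ sz l := by
  induction l with
  | nil => cases h
  | cons b l ih =>
    rw [sz_cons]
    have := sz_pos l
    rcases List.mem_cons.1 h with rfl | h
    · omega
    · have := ih h
      omega

theorem length_le_sz (l : List α) : l.length ≤ sz l := by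
  induction l with
  | nil => simp
  | cons b l ih =>
    rw [sz_cons, List.length_cons]
    omega

theorem sz_nat (n : ℕ) : sz n = 2 * n + 1 := by
  induction n with
  | zero => rfl
  | succ n ih =>
    change sz (() :: List.replicate n ()) = _
    rw [sz_cons]
    change 1 + sz n + 1 = _
    omega

theorem sz_bits (l : List Bool) : sz l = 2 * l.length + 1 := by
  rw [sz, enc_bits, size_ofBits]

end Sizes

/-- Coefficients in `ℕ` make polynomials monotone, so a bound for a size can be substituted into a
time bound. -/
theorem eval_mono (q : Polynomial ℕ) {m n : ℕ} (h : m ≤ n) : q.eval m ≤ q.eval n := by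
  rw [Polynomial.eval_eq_sum_range, Polynomial.eval_eq_sum_range]
  exact Finset.sum_le_sum fun i _ => Nat.mul_le_mul_left _ (Nat.pow_le_pow_left h i)

/-- `s a` is polynomially bounded in the size of `a`. -/
def PolyBd {α : Type} [Enc α] (s : α → ℕ) : Prop :=
  ∃ q : Polynomial ℕ, ∀ a, s a ≤ q.eval (sz a)

namespace PolyBd

variable {α β : Type} [Enc α] [Enc β] {s t : α → ℕ}

theorem const (n : ℕ) : PolyBd (fun _ : α => n) := ⟨.C n, by simp⟩

theorem mono (h : PolyBd t) (hs : ∀ a, s a ≤ t a) : PolyBd s :=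
  h.imp fun _ hq a => (hs a).trans (hq a)

theorem size : PolyBd (sz : α → ℕ) := ⟨.X, by simp⟩

theorem add (hs : PolyBd s) (ht : PolyBd t) : PolyBd (fun a => s a + t a) := by
  obtain ⟨q, hq⟩ := hs
  obtain ⟨r, hr⟩ := ht
  exact ⟨q + r, fun a => by simpa using add_le_add (hq a) (hr a)⟩

theorem mul (hs : PolyBd s) (ht : PolyBd t) : PolyBd (fun a => s a * t a) := by
  obtain ⟨q, hq⟩ := hs
  obtain ⟨r, hr⟩ := ht
  exact ⟨q * r, fun a => by simpa using Nat.mul_le_mul (hq a) (hr a)⟩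

theorem eval (q : Polynomial ℕ) (hs : PolyBd s) : PolyBd (fun a => q.eval (s a)) := by
  obtain ⟨r, hr⟩ := hs
  exact ⟨q.comp r, fun a => by simpa using eval_mono q (hr a)⟩

end PolyBd

/-- `f` is computed by a deterministic program in polynomial time. -/
def Poly {α β : Type} [Enc α] [Enc β] (f : α → β) : Prop :=
  ∃ (c : Code) (T : α → ℕ), PolyBd T ∧ ∀ a, ∃ t ≤ T a, Runs c (enc a) (enc (f a)) t

/-! ### Closure of polynomial time under the program constructs -/

section Closure

variable {α β γ δ σ : Type} [Enc α] [Enc β] [Enc γ] [Enc δ] [Enc σ]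

theorem Poly.of_atomic {f : α → β} (c : Code)
    (h : ∀ k a, c.exec₀ k (enc a) = some (enc (f a), (enc a).size)) : Poly f :=
  ⟨c, sz, .size, fun a => ⟨_, le_rfl, fun k _ => h k a⟩⟩

/-- A running time also bounds the output size; this is what makes composition possible. -/
theorem Poly.bd {f : α → β} (hf : Poly f) : PolyBd (fun a => sz (f a)) := by
  obtain ⟨c, T, hT, h⟩ := hf
  refine ((PolyBd.const c.growth).mul hT).mono fun a => ?_
  obtain ⟨t, ht, h⟩ := h a
  exact h.size_le.trans (Nat.mul_le_mul_left _ ht)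

theorem PolyBd.comp {s : β → ℕ} {f : α → β} (hs : PolyBd s) (hf : Poly f) :
    PolyBd (fun a => s (f a)) := by
  obtain ⟨q, hq⟩ := hs
  exact (hf.bd.eval q).mono fun a => hq (f a)

theorem Poly.id : Poly (fun a : α => a) := .of_atomic .id fun _ _ => rfl

theorem Poly.encode : Poly (enc : α → Data) := .of_atomic .id fun _ _ => rfl

theorem Poly.const (b : β) : Poly (fun _ : α => b) :=
  .of_atomic (.const (Enc.enc b)) fun _ _ => rfl

theorem Poly.comp {g : β → γ} {f : α → β} (hg : Poly g) (hf : Poly f) :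
    Poly (fun a => g (f a)) := by
  have hf' := hf
  obtain ⟨c, S, hS, hc⟩ := hf
  obtain ⟨d, T, hT, hd⟩ := hg
  refine ⟨.comp d c, _, PolyBd.size.add (hS.add (hT.comp hf')), fun a => ?_⟩
  obtain ⟨s, hs, h1⟩ := hc a
  obtain ⟨t, ht, h2⟩ := hd (f a)
  exact ⟨_, add_le_add le_rfl (add_le_add hs ht), h1.comp h2⟩

theorem Poly.pair {f : α → β} {g : α → γ} (hf : Poly f) (hg : Poly g) :
    Poly (fun a => (f a, g a)) := by
  obtain ⟨c, S, hS, hc⟩ := hf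
  obtain ⟨d, T, hT, hd⟩ := hg
  refine ⟨.pair c d, _, PolyBd.size.add (hS.add hT), fun a => ?_⟩
  obtain ⟨s, hs, h1⟩ := hc a
  obtain ⟨t, ht, h2⟩ := hd a
  exact ⟨_, add_le_add le_rfl (add_le_add hs ht), h1.pair h2⟩

theorem Poly.fst {f : α → β × γ} (hf : Poly f) : Poly (fun a => (f a).1) :=
  Poly.comp (g := Prod.fst) (.of_atomic .fst fun _ _ => rfl) hf

theorem Poly.snd {f : α → β × γ} (hf : Poly f) : Poly (fun a => (f a).2) :=
  Poly.comp (g := Prod.snd) (.of_atomic .snd fun _ _ => rfl) hf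

theorem Poly.ite {c : α → Bool} {f g : α → β} (hc : Poly c) (hf : Poly f) (hg : Poly g) :
    Poly (fun a => if c a then f a else g a) := by
  obtain ⟨c', R, hR, hc⟩ := hc
  obtain ⟨f', S, hS, hf⟩ := hf
  obtain ⟨g', T, hT, hg⟩ := hg
  refine ⟨.cond c' f' g', _, PolyBd.size.add (hR.add (hS.add hT)), fun a => ?_⟩
  obtain ⟨r, hr, h1⟩ := hc a
  obtain ⟨s, hs, h2⟩ := hf a
  obtain ⟨t, ht, h3⟩ := hg a
  beta_reduce
  cases e : c a
  · rw [e] at h1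
    rw [if_neg Bool.false_ne_true]
    exact ⟨_, add_le_add le_rfl (add_le_add hr (ht.trans (Nat.le_add_left _ _))),
      h1.cond_false (by simp [Enc.enc]) h3⟩
  · rw [e] at h1
    rw [if_pos rfl]
    exact ⟨_, add_le_add le_rfl (add_le_add hr (hs.trans (Nat.le_add_right _ _))), h1.cond_true h2⟩

theorem Poly.dataFst {f : α → Data} (hf : Poly f) : Poly (fun a => (f a).fst) :=
  Poly.comp (g := Data.fst) (.of_atomic .fst fun _ _ => rfl) hf

theorem Poly.dataSnd {f : α → Data} (hf : Poly f) : Poly (fun a => (f a).snd) :=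
  Poly.comp (g := Data.snd) (.of_atomic .snd fun _ _ => rfl) hf

theorem Poly.dataIsPair {f : α → Data} (hf : Poly f) : Poly (fun a => (f a).isPair) :=
  Poly.comp (g := Data.isPair) (.of_atomic .isPair fun _ _ => rfl) hf

theorem Poly.dataEq {f g : α → Data} (hf : Poly f) (hg : Poly g) :
    Poly (fun a => decide (f a = g a)) :=
  Poly.comp (g := fun p : Data × Data => decide (p.1 = p.2))
    (.of_atomic .eq fun _ _ => rfl) (hf.pair hg)

/-- Re-encoding. -/
theorem Poly.cast {f : α → β} {g : α → γ} (hf : Poly f) (h : ∀ a, Enc.enc (f a) = Enc.enc (g a)) :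
    Poly g := by
  obtain ⟨c, T, hT, hc⟩ := hf
  exact ⟨c, T, hT, fun a => h a ▸ hc a⟩

/-- A given algorithm is run with its time bound as fuel; `Runs.of_exec₀` frees the execution from
that particular bound. -/
theorem Poly.run (M : PolyTime) {f : α → Data} (hf : Poly f) : Poly (fun a => M.run (f a)) := by
  refine Poly.comp (g := M.run) ⟨M.code, fun v => M.time.eval (sz v), PolyBd.size.eval _, fun v => ?_⟩
    hf
  obtain ⟨d, t, h, ht⟩ := M.halts v
  refine ⟨t, ht, ?_⟩
  simp only [PolyTime.run, h]
  exact Runs.of_exec₀ h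

theorem Poly.cons {f : α → β} {g : α → List β} (hf : Poly f) (hg : Poly g) :
    Poly (fun a => f a :: g a) :=
  (hf.pair hg).cast fun _ => rfl

/-- There are no local variables, so the list is recomputed for the test, for its head and for its
tail; this costs only a constant factor. -/
theorem Poly.listCases {l : α → List γ} {n : α → β} {c : α × γ × List γ → β} (hl : Poly l)
    (hn : Poly n) (hc : Poly c) :
    Poly (fun a => match l a with | [] => n a | x :: t => c (a, x, t)) := by
  obtain ⟨l', R, hR, hl'⟩ := hl
  obtain ⟨n', S, hS, hn'⟩ := hn
  obtain ⟨c', q, hc'⟩ := hc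
  obtain ⟨⟨q, hq⟩, hc'⟩ := hc'
  have hl2 : PolyBd fun a => sz (l a) := Poly.bd ⟨l', R, hR, hl'⟩
  refine ⟨.cond (.comp .isPair l') (.comp c' (.pair .id (.pair (.comp .fst l') (.comp .snd l')))) n',
    fun a => sz a + ((sz a + (R a + sz (l a))) + ((sz a + ((sz a + (sz a + (sz a +
      ((sz a + (R a + sz (l a))) + (sz a + (R a + sz (l a))))))) +
      q.eval (sz a + sz (l a) + 1))) + S a)), ?_, fun a => ?_⟩
  · have h0 := PolyBd.size (α := α)
    have h1 := h0.add (hR.add hl2)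
    exact h0.add (h1.add ((h0.add ((h0.add (h0.add (h0.add (h1.add h1)))).add
      (((h0.add hl2).add (.const 1)).eval q))).add hS))
  · obtain ⟨r, hr, h1⟩ := hl' a
    obtain ⟨s, hs, h2⟩ := hn' a
    beta_reduce
    rcases e : l a with _ | ⟨x, t⟩
    · rw [e] at h1
      have h3 : Runs .isPair (Enc.enc ([] : List γ)) (bit false) (sz ([] : List γ)) :=
        fun k _ => rfl
      refine ⟨_, ?_, (h1.comp h3).cond_false (by simp) h2⟩
      change sz a + (sz a + (r + _) + s) ≤ _
      omega
    · rw [e] at h1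
      have h3 : Runs .isPair (Enc.enc (x :: t)) (bit true) (sz (x :: t)) :=
        fun k _ => rfl
      have h4 : Runs .fst (Enc.enc (x :: t)) (Enc.enc x) (sz (x :: t)) :=
        fun k _ => rfl
      have h5 : Runs .snd (Enc.enc (x :: t)) (Enc.enc t) (sz (x :: t)) :=
        fun k _ => rfl
      have h6 : Runs .id (Enc.enc a) (Enc.enc a) (sz a) :=
        fun k _ => rfl
      obtain ⟨u, hu, h7⟩ := hc' (a, x, t)
      refine ⟨_, ?_, (h1.comp h3).cond_true ((h6.pair ((h1.comp h4).pair (h1.comp h5))).comp h7)⟩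
      have h8 : sz (a, x, t) = sz a + sz (x :: t) + 1 := rfl
      have h9 := hq (a, x, t)
      rw [h8] at h9
      change sz a + (sz a + (r + _) + (sz a + (sz a + (sz a + (sz a + (sz a + (r + _) +
        (sz a + (r + _))))) + u))) ≤ _
      omega

/-- Polynomially many polynomial-time steps need not take polynomial time, as the state may double
in every round. Hence the a priori bound `B` on all intermediate states, not only on the final one.
-/
theorem Poly.iterate {c : σ → Bool} {f : σ → σ} {j : α → σ} {N B : α → ℕ} (hc : Poly c)
    (hf : Poly f) (hj : Poly j) (hN : PolyBd N) (hB : PolyBd B)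
    (hsz : ∀ a, ∀ i ≤ N a, sz (f^[i] (j a)) ≤ B a)
    (hgo : ∀ a, ∀ i < N a, c (f^[i] (j a)) = true) (hexit : ∀ a, c (f^[N a] (j a)) = false) :
    Poly (fun a => f^[N a] (j a)) := by
  obtain ⟨c', S, ⟨q, hq⟩, hc⟩ := hc
  obtain ⟨f', T, ⟨r, hr⟩, hf⟩ := hf
  obtain ⟨j', U, hU, hj⟩ := hj
  refine ⟨.comp (.loop c' f') j', fun a => sz a + (U a + (N a + 1) *
    (B a + q.eval (B a) + r.eval (B a))), ?_, fun a => ?_⟩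
  · exact PolyBd.size.add (hU.add ((hN.add (.const 1)).mul ((hB.add (hB.eval q)).add (hB.eval r))))
  · obtain ⟨u, hu, h1⟩ := hj a
    -- Induction on the number `i` of remaining rounds, starting from the state after `N a - i`
    -- rounds. There are `N a + 1` tests, one more than the executions of the body.
    suffices ∀ i ≤ N a, ∃ t ≤ (i + 1) * (B a + q.eval (B a) + r.eval (B a)),
        LoopRuns c' f' (Enc.enc (f^[N a - i] (j a))) (Enc.enc (f^[N a] (j a))) t by
      obtain ⟨t, ht, h2⟩ := this (N a) le_rfl
      rw [Nat.sub_self] at h2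
      exact ⟨_, add_le_add le_rfl (add_le_add hu ht), h1.comp h2.runs⟩
    intro i hi
    have h2 := hsz a (N a - i) (by omega)
    have h3 := (hq (f^[N a - i] (j a))).trans (eval_mono q h2)
    have h4 := (hr (f^[N a - i] (j a))).trans (eval_mono r h2)
    obtain ⟨s, hs, h5⟩ := hc (f^[N a - i] (j a))
    induction i generalizing s with
    | zero =>
      rw [Nat.sub_zero] at *
      rw [hexit] at h5
      refine ⟨_, ?_, LoopRuns.exit h5 (by simp [Enc.enc])⟩
      change sz _ + s ≤ _
      omega
    | succ i ih =>
      have h2' := hsz a (N a - i) (by omega)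
      have h3' := (hq (f^[N a - i] (j a))).trans (eval_mono q h2')
      have h4' := (hr (f^[N a - i] (j a))).trans (eval_mono r h2')
      obtain ⟨s', hs', h5'⟩ := hc (f^[N a - i] (j a))
      obtain ⟨t, ht, h6⟩ := ih (by omega) h2' h3' h4' s' hs' h5'
      obtain ⟨w, hw, h7⟩ := hf (f^[N a - (i + 1)] (j a))
      rw [hgo a _ (by omega)] at h5
      have e : N a - i = (N a - (i + 1)) + 1 := by omega
      rw [e, Function.iterate_succ_apply'] at h6
      refine ⟨_, ?_, LoopRuns.step h5 h7 h6⟩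
      change sz _ + (s + (w + t)) ≤ _
      rw [add_mul _ 1]
      omega

end Closure

/-! ### Lists and unary numbers in polynomial time -/

section Lists

variable {α β γ δ σ : Type}

/-- A fold as a while loop whose state is the unread list, the accumulator and the unchanged
parameter. The step fixes the state once the list is exhausted, so the formula holds for every `k`.
-/
theorem foldl_iterate (s : α × σ × γ → σ) (l : List γ) (i : σ) (a : α) (k : ℕ) :
    (fun p : List γ × σ × α => match p.1 with
      | [] => p
      | x :: t => (t, s (p.2.2, p.2.1, x), p.2.2))^[k] (l, i, a) =
      (l.drop k, (l.take k).foldl (fun acc x => s (a, acc, x)) i, a) := by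
  induction k generalizing l i with
  | zero => simp
  | succ k ih =>
    rw [Function.iterate_succ_apply]
    cases l with
    | nil => simpa using ih [] i
    | cons x t => simpa using ih t _

theorem foldl_units (f : σ → σ) (n : ℕ) (i : σ) :
    (List.replicate n ()).foldl (fun acc _ => f acc) i = f^[n] i := by
  induction n generalizing i with
  | zero => rfl
  | succ n ih => simp [List.replicate_succ, ih]

theorem iterate_tail (l : List γ) (n : ℕ) : List.tail^[n] l = l.drop n := by
  induction n generalizing l with
  | zero => rfl
  | succ n ih => rw [Function.iterate_succ_apply, ih, List.drop_tail]

variable [Enc α] [Enc β] [Enc γ] [Enc δ] [Enc σ]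

theorem Poly.foldl {l : α → List γ} {i : α → σ} {s : α × σ × γ → σ} (hl : Poly l) (hi : Poly i)
    (hs : Poly s) {B : α → ℕ} (hB : PolyBd B)
    (hb : ∀ a k, sz (((l a).take k).foldl (fun acc x => s (a, acc, x)) (i a)) ≤ B a) :
    Poly (fun a => (l a).foldl (fun acc x => s (a, acc, x)) (i a)) := by
  have hf : Poly (fun p : List γ × σ × α => match p.1 with
      | [] => p
      | x :: t => (t, s (p.2.2, p.2.1, x), p.2.2)) :=
    Poly.listCases (c := fun q : (List γ × σ × α) × γ × List γ =>
      (q.2.2, s (q.1.2.2, q.1.2.1, q.2.1), q.1.2.2)) Poly.id.fst Poly.id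
      (Poly.id.snd.snd.pair ((hs.comp (Poly.id.fst.snd.snd.pair (Poly.id.fst.snd.fst.pair
        Poly.id.snd.fst))).pair Poly.id.fst.snd.snd))
  have hc : Poly (fun p : List γ × σ × α => match p.1 with
      | [] => false
      | _ :: _ => true) :=
    Poly.listCases (c := fun q : (List γ × σ × α) × γ × List γ => true) Poly.id.fst (.const _)
      (.const _)
  have hsz : ∀ (m : List γ) k, sz (m.drop k) ≤ sz m := by
    intro m
    induction m with
    | nil => simp
    | cons x t ih =>
      intro k
      cases k with
      | zero => simp
      | succ k =>
        rw [List.drop_succ_cons, sz_cons]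
        have := ih k
        omega
  have := Poly.iterate hc hf (hl.pair (hi.pair Poly.id)) (N := fun a => (l a).length)
    (B := fun a => sz (l a) + (B a + sz a + 1) + 1)
    (hl.bd.mono fun a => length_le_sz _)
    ((hl.bd.add ((hB.add .size).add (.const 1))).add (.const 1))
    (fun a k _ => by
      rw [foldl_iterate, sz_pair, sz_pair]
      have := hb a k
      have := hsz (l a) k
      omega)
    (fun a k hk => by
      rw [foldl_iterate, List.drop_eq_getElem_cons hk])
    (fun a => by simp [foldl_iterate])
  exact this.snd.fst.cast fun a => by simp [foldl_iterate]

/-- If a step enlarges the accumulator by an amount that does not depend on the accumulator, the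
growth over the whole list is at most linear in its length. -/
theorem Poly.foldl_of_add {l : α → List γ} {i : α → σ} {s : α × σ × γ → σ} (hl : Poly l)
    (hi : Poly i) (hs : Poly s) {B : α → ℕ} (hB : PolyBd B)
    (hb : ∀ a acc x, x ∈ l a → sz (s (a, acc, x)) ≤ sz acc + B a) :
    Poly (fun a => (l a).foldl (fun acc x => s (a, acc, x)) (i a)) := by
  refine Poly.foldl hl hi hs (hi.bd.add (hl.bd.mul hB)) fun a k => ?_
  have key : ∀ (m : List γ) (acc : σ), (∀ x ∈ m, x ∈ l a) →
      sz (m.foldl (fun acc x => s (a, acc, x)) acc) ≤ sz acc + m.length * B a := by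
    intro m
    induction m with
    | nil => simp
    | cons x t ih =>
      intro acc hm
      have h1 := ih (s (a, acc, x)) fun y hy => hm y (List.mem_cons_of_mem _ hy)
      have h2 := hb a acc x (hm x (by simp))
      rw [List.foldl_cons, List.length_cons, add_mul]
      omega
  refine (key _ _ fun x hx => List.mem_of_mem_take hx).trans ?_
  have : ((l a).take k).length ≤ sz (l a) := (List.length_take_le' _ _).trans (length_le_sz _)
  exact Nat.add_le_add_left (Nat.mul_le_mul_right _ this) _

theorem Poly.reverseAppend {f g : α → List γ} (hf : Poly f) (hg : Poly g) :
    Poly (fun a => (f a).reverse ++ g a) := by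
  have := Poly.foldl_of_add (s := fun q : α × List γ × γ => q.2.2 :: q.2.1) hf hg
    (Poly.id.snd.snd.cons Poly.id.snd.fst) (hf.bd.add (.const 1)) (fun a acc x hx => by
      have := sz_mem hx
      simp only [sz_cons]
      omega)
  refine this.cast fun a => congrArg enc ?_
  generalize f a = l
  generalize g a = m
  induction l generalizing m with
  | nil => rfl
  | cons x t ih => simp [ih]

theorem Poly.reverse {f : α → List γ} (hf : Poly f) : Poly (fun a => (f a).reverse) :=
  (hf.reverseAppend (.const [])).cast fun a => by simp

theorem Poly.append {f g : α → List γ} (hf : Poly f) (hg : Poly g) : Poly (fun a => f a ++ g a) :=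
  (hf.reverse.reverseAppend hg).cast fun a => by simp

theorem Poly.map {l : α → List γ} {s : α × γ → δ} (hl : Poly l) (hs : Poly s) :
    Poly (fun a => (l a).map fun x => s (a, x)) := by
  obtain ⟨q, hq⟩ := hs.bd
  have := Poly.foldl_of_add (s := fun q : α × List δ × γ => s (q.1, q.2.2) :: q.2.1) hl
    (.const []) ((hs.comp (Poly.id.fst.pair Poly.id.snd.snd)).cons Poly.id.snd.fst)
    (((((PolyBd.size.add hl.bd).add (.const 1)).eval q).add (.const 1))) (fun a acc x hx => by
      have h1 := sz_mem hx
      have h2 : sz (s (a, x)) ≤ _ := (hq (a, x)).trans (eval_mono q (n := sz a + sz (l a) + 1)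
        (by rw [sz_pair]; omega))
      simp only [sz_cons]
      omega)
  refine this.reverse.cast fun a => congrArg enc ?_
  suffices ∀ (m : List γ) (acc : List δ),
      m.foldl (fun acc x => s (a, x) :: acc) acc = (m.map fun x => s (a, x)).reverse ++ acc by
    simp [this]
  intro m
  induction m with
  | nil => simp
  | cons x t ih => simp [ih]

theorem Poly.length {l : α → List γ} (hl : Poly l) : Poly (fun a => (l a).length) :=
  (Poly.map (s := fun _ => ()) hl (.const ())).cast fun a => by
    simp only [List.map_const']
    rfl

theorem Poly.units {n : α → ℕ} (hn : Poly n) : Poly (fun a => List.replicate (n a) ()) :=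
  hn.cast fun _ => rfl

theorem Poly.replicate {n : α → ℕ} {f : α → β} (hn : Poly n) (hf : Poly f) :
    Poly (fun a => List.replicate (n a) (f a)) :=
  (Poly.map (s := fun p : α × Unit => f p.1) hn.units (hf.comp Poly.id.fst)).cast fun a => by simp

theorem Poly.tail {l : α → List γ} (hl : Poly l) : Poly (fun a => (l a).tail) :=
  (Poly.listCases (c := fun q : α × γ × List γ => q.2.2) hl (.const []) Poly.id.snd.snd).cast
    fun a => by cases l a <;> rfl

theorem Poly.drop {n : α → ℕ} {l : α → List γ} (hn : Poly n) (hl : Poly l) :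
    Poly (fun a => (l a).drop (n a)) := by
  have := Poly.foldl_of_add (s := fun q : α × List γ × Unit => q.2.1.tail) hn.units hl
    Poly.id.snd.fst.tail (.const 0) (fun a acc x _ => by
      cases acc with
      | nil => simp
      | cons y t => simp only [List.tail_cons, sz_cons]; omega)
  exact this.cast fun a => by rw [foldl_units, iterate_tail]

theorem Poly.take {n : α → ℕ} {l : α → List γ} (hn : Poly n) (hl : Poly l) :
    Poly (fun a => (l a).take (n a)) := by
  have hs : Poly (fun q : List γ × List γ => match q.1 with
      | [] => q
      | x :: t => (t, x :: q.2)) :=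
    Poly.listCases (c := fun r : (List γ × List γ) × γ × List γ => (r.2.2, r.2.1 :: r.1.2))
      Poly.id.fst Poly.id (Poly.id.snd.snd.pair (Poly.id.snd.fst.cons Poly.id.fst.snd))
  have := Poly.foldl_of_add (s := fun q : α × (List γ × List γ) × Unit => match q.2.1.1 with
      | [] => q.2.1
      | x :: t => (t, x :: q.2.1.2)) hn.units (hl.pair (.const []))
    (hs.comp Poly.id.snd.fst) (.const 0) (fun a acc x _ => by
      obtain ⟨m, acc⟩ := acc
      cases m with
      | nil => simp
      | cons y t => simp only [sz_pair, sz_cons]; omega)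
  refine this.snd.reverse.cast fun a => congrArg enc ?_
  rw [foldl_units (fun q : List γ × List γ => match q.1 with
      | [] => q
      | x :: t => (t, x :: q.2))]
  suffices ∀ (n : ℕ) (m acc : List γ), ((fun q : List γ × List γ => match q.1 with
      | [] => q
      | x :: t => (t, x :: q.2))^[n] (m, acc)).2 = (m.take n).reverse ++ acc by simp [this]
  intro n
  induction n with
  | zero => simp
  | succ n ih =>
    intro m acc
    rw [Function.iterate_succ_apply]
    cases m with
    | nil => simpa using ih [] acc
    | cons x t => simpa using ih t _

theorem Poly.natAdd {m n : α → ℕ} (hm : Poly m) (hn : Poly n) : Poly (fun a => m a + n a) :=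
  (hm.units.append hn.units).cast fun a => by
    rw [← List.replicate_add]
    rfl

theorem Poly.natMul {m n : α → ℕ} (hm : Poly m) (hn : Poly n) : Poly (fun a => m a * n a) := by
  have := Poly.foldl_of_add (s := fun q : α × ℕ × Unit => q.2.1 + n q.1) hm.units (.const 0)
    (Poly.id.snd.fst.natAdd (hn.comp Poly.id.fst)) hn.bd (fun a acc x _ => by
      simp only [sz_nat]
      omega)
  refine this.cast fun a => congrArg enc ?_
  rw [foldl_units (fun x => x + n a)]
  simp

theorem Poly.natEval (q : Polynomial ℕ) {n : α → ℕ} (hn : Poly n) :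
    Poly (fun a => q.eval (n a)) := by
  induction q using Polynomial.induction_on' with
  | add p q hp hq => exact (hp.natAdd hq).cast fun a => by simp
  | monomial k c =>
    induction k with
    | zero => exact (Poly.const c).cast fun a => by simp
    | succ k ih => exact (ih.natMul hn).cast fun a => by simp [pow_succ, mul_assoc]

/-- In unary, `m < n` holds exactly when dropping `m` units from `n` leaves something. -/
theorem Poly.natLt {m n : α → ℕ} (hm : Poly m) (hn : Poly n) :
    Poly (fun a => decide (m a < n a)) :=
  (Poly.listCases (n := fun _ => false) (c := fun _ : α × Unit × List Unit => true)
    (hm.drop hn.units) (.const _) (.const _)).cast fun a => by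
      rw [List.drop_replicate]
      by_cases h : m a < n a
      · obtain ⟨k, hk⟩ : ∃ k, n a - m a = k + 1 := ⟨n a - m a - 1, by omega⟩
        rw [hk, decide_eq_true h]
        rfl
      · have : n a - m a = 0 := by omega
        rw [this, decide_eq_false h]
        rfl

end Lists

/-- The elements of a tree that is read as a list. -/
def Data.toList : Data → List Data
  | .pair a b => a :: toList b
  | _ => []

theorem toBits_eq (d : Data) : toBits d = d.toList.map fun a => decide (a = bit true) := by
  induction d with
  | nil => rfl
  | bit b => rfl
  | pair a b _ ih => simp [toBits, Data.toList, ih]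

theorem Data.length_toList_le (d : Data) : d.toList.length ≤ d.size := by
  induction d with
  | nil => simp [toList]
  | bit b => simp [toList]
  | pair a b _ ih =>
    simp only [toList, size, List.length_cons]
    omega

theorem length_toBits_le (d : Data) : (toBits d).length ≤ d.size := by
  rw [toBits_eq, List.length_map]
  exact d.length_toList_le

/-- Reading a tree along its right spine moves nodes from the tree to the list, so the joint size
never grows; this is the bound needed for `Poly.iterate`. -/
theorem toList_iterate (k : ℕ) (d : Data) (acc : List Data) : k ≤ d.toList.length →
    ∃ e : Data, (fun p : Data × List Data => (p.1.snd, p.1.fst :: p.2))^[k] (d, acc) =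
      (e, (d.toList.take k).reverse ++ acc) ∧ e.toList = d.toList.drop k ∧
      e.size + sz ((d.toList.take k).reverse ++ acc) ≤ d.size + sz acc := by
  induction k generalizing d acc with
  | zero => simp
  | succ k ih =>
    intro h
    cases d with
    | nil => simp [Data.toList] at h
    | bit => simp [Data.toList] at h
    | pair a b =>
      obtain ⟨e, h1, h2, h3⟩ := ih b (a :: acc) (by simpa [Data.toList] using h)
      refine ⟨e, ?_, ?_, ?_⟩
      · rw [Function.iterate_succ_apply]
        simpa [Data.toList, Data.fst, Data.snd] using h1
      · simpa [Data.toList] using h2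
      · rw [sz_cons] at h3
        simp only [Data.toList, List.take_succ_cons, List.reverse_cons, List.append_assoc,
          List.singleton_append, Data.size]
        have : sz a = a.size := rfl
        omega

theorem Data.isPair_eq (d : Data) : d.isPair = !d.toList.isEmpty := by
  cases d <;> rfl

section

variable {α : Type} [Enc α]

theorem Poly.toList {f : α → Data} (hf : Poly f) : Poly (fun a => (f a).toList) := by
  have h : Poly (fun p : Data × List Data => (p.1.snd, p.1.fst :: p.2)) :=
    Poly.id.fst.dataSnd.pair (Poly.id.fst.dataFst.cons Poly.id.snd)
  have := Poly.iterate (c := fun p : Data × List Data => p.1.isPair) Poly.id.fst.dataIsPair h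
    ((Poly.id (α := Data)).pair (.const ([] : List Data)))
    (N := fun d => d.toList.length) (B := fun d => sz d + 2)
    (PolyBd.size.mono fun d => d.length_toList_le) (PolyBd.size.add (.const 2))
    (fun d k hk => by
      obtain ⟨e, h1, h2, h3⟩ := toList_iterate k d [] hk
      rw [h1, sz_pair]
      rw [sz_nil] at h3
      change e.size + _ + 1 ≤ d.size + 2
      omega)
    (fun d k hk => by
      obtain ⟨e, h1, h2, -⟩ := toList_iterate k d [] hk.le
      rw [h1, Data.isPair_eq, h2, List.drop_eq_getElem_cons hk]
      rfl)
    (fun d => by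
      obtain ⟨e, h1, h2, -⟩ := toList_iterate _ d [] le_rfl
      rw [h1, Data.isPair_eq, h2]
      simp)
  refine Poly.comp (g := Data.toList) (this.snd.reverse.cast fun d => ?_) hf
  obtain ⟨e, h1, -⟩ := toList_iterate _ d [] le_rfl
  rw [h1]
  simp

theorem Poly.dataToBits {f : α → Data} (hf : Poly f) : Poly (fun a => toBits (f a)) :=
  (Poly.map (s := fun p : α × Data => decide (p.2 = bit true)) hf.toList
    (Poly.id.snd.dataEq (.const _))).cast fun a => by rw [toBits_eq]

theorem Poly.dataOfBits {f : α → List Bool} (hf : Poly f) : Poly (fun a => ofBits (f a)) :=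
  hf.cast fun _ => enc_bits _

theorem Poly.dataPair {f g : α → Data} (hf : Poly f) (hg : Poly g) :
    Poly (fun a => Data.pair (f a) (g a)) := (hf.pair hg).cast fun _ => rfl

end

/-- A typed polynomial-time function on trees as an algorithm. -/
theorem Poly.exists_polyTime {β : Type} [Enc β] {f : Data → β} (hf : Poly f) :
    ∃ M : PolyTime, ∀ v, M.run v = enc (f v) := by
  obtain ⟨c, T, ⟨q, hq⟩, hc⟩ := hf
  have key : ∀ v : Data, ∃ t, c.exec₀ (q.eval v.size) v = some (enc (f v), t) ∧
      t ≤ q.eval v.size := fun v => by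
    obtain ⟨t, ht, h⟩ := hc v
    exact ⟨t, h _ (ht.trans (hq v)), ht.trans (hq v)⟩
  refine ⟨⟨c, q, fun v => ⟨_, key v⟩⟩, fun v => ?_⟩
  obtain ⟨t, h, -⟩ := key v
  simp [PolyTime.run, h]

open scoped ENNReal

/-! ## Expectations over discrete distributions -/

/-- The expectation of a nonnegative function. -/
noncomputable def ex {α : Type*} (μ : PMF α) (f : α → ℝ≥0∞) : ℝ≥0∞ := ∑' a, μ a * f a

section Expectation

variable {α β : Type*} (μ : PMF α)

theorem ex_pure (a : α) (f : α → ℝ≥0∞) : ex (PMF.pure a) f = f a := by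
  rw [ex, tsum_eq_single a]
  · simp
  · intro b hb
    simp [PMF.pure_apply, hb]

theorem ex_bind (ν : α → PMF β) (f : β → ℝ≥0∞) :
    ex (μ.bind ν) f = ex μ fun a => ex (ν a) f := by
  simp only [ex, PMF.bind_apply, ← ENNReal.tsum_mul_right, ← ENNReal.tsum_mul_left]
  rw [ENNReal.tsum_comm]
  simp only [mul_assoc]

theorem ex_map (g : α → β) (f : β → ℝ≥0∞) : ex (μ.map g) f = ex μ fun a => f (g a) := by
  rw [PMF.map, ex_bind]
  simp only [Function.comp, ex_pure]

theorem ex_mono {f g : α → ℝ≥0∞} (h : ∀ a ∈ μ.support, f a ≤ g a) : ex μ f ≤ ex μ g := by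
  refine ENNReal.tsum_le_tsum fun a => ?_
  by_cases ha : a ∈ μ.support
  · exact mul_le_mul_right (h a ha) _
  · rw [PMF.mem_support_iff, not_not] at ha
    simp [ha]

theorem ex_congr {f g : α → ℝ≥0∞} (h : ∀ a ∈ μ.support, f a = g a) : ex μ f = ex μ g :=
  le_antisymm (ex_mono μ fun a ha => (h a ha).le) (ex_mono μ fun a ha => (h a ha).ge)

theorem ex_const (c : ℝ≥0∞) : ex μ (fun _ => c) = c := by
  rw [ex, ENNReal.tsum_mul_right, PMF.tsum_coe, one_mul]

theorem ex_add (f g : α → ℝ≥0∞) : ex μ (fun a => f a + g a) = ex μ f + ex μ g := by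
  simp only [ex, mul_add, ENNReal.tsum_add]

theorem ex_mul_left (c : ℝ≥0∞) (f : α → ℝ≥0∞) : ex μ (fun a => c * f a) = c * ex μ f := by
  simp only [ex, ← ENNReal.tsum_mul_left]
  exact tsum_congr fun a => by ring

theorem ex_mul_right (c : ℝ≥0∞) (f : α → ℝ≥0∞) : ex μ (fun a => f a * c) = ex μ f * c := by
  simp only [mul_comm _ c, ex_mul_left]

theorem ex_le_one {f : α → ℝ≥0∞} (h : ∀ a, f a ≤ 1) : ex μ f ≤ 1 :=
  (ex_mono μ fun a _ => h a).trans (ex_const μ 1).le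

/-- The indicator of an event. -/
noncomputable def ind (p : Prop) : ℝ≥0∞ := by
  classical exact if p then 1 else 0

theorem ind_true {p : Prop} (h : p) : ind p = 1 := if_pos h

theorem ind_false {p : Prop} (h : ¬p) : ind p = 0 := if_neg h

theorem ind_le_one (p : Prop) : ind p ≤ 1 := by
  by_cases h : p
  · exact (ind_true h).le
  · exact (ind_false h).le.trans zero_le_one

theorem ex_ind_eq (a : α) : ex μ (fun b => ind (b = a)) = μ a := by
  rw [ex, tsum_eq_single a]
  · rw [ind_true rfl, mul_one]
  · intro b hb
    rw [ind_false hb, mul_zero]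

theorem pmf_bind_congr {ν ν' : α → PMF β} (h : ∀ a ∈ μ.support, ν a = ν' a) :
    μ.bind ν = μ.bind ν' := by
  ext b
  simp only [PMF.bind_apply]
  refine tsum_congr fun a => ?_
  by_cases ha : a ∈ μ.support
  · rw [h a ha]
  · rw [PMF.mem_support_iff, not_not] at ha
    simp [ha]

end Expectation

/-- A test with values in `[0, 1]` cannot tell two distributions better than by their statistical
distance. -/
theorem ex_le_add_statDist {α : Type*} (X Y : PMF α) (T : α → ℝ≥0∞) (hT : ∀ a, T a ≤ 1) :
    ex X T ≤ ex Y T + ENNReal.ofReal (statDist X Y) := by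
  have sumX : ∀ Z : PMF α, Summable fun a => (Z a).toReal := fun Z =>
    ENNReal.summable_toReal (by simp)
  have one : ∀ Z : PMF α, ∑' a, (Z a).toReal = 1 := fun Z => by
    rw [← ENNReal.tsum_toReal_eq (fun a => Z.apply_ne_top a), Z.tsum_coe, ENNReal.toReal_one]
  have hT0 : ∀ a, T a ≠ ⊤ := fun a => ne_top_of_le_ne_top ENNReal.one_ne_top (hT a)
  have hT1 : ∀ a, (T a).toReal ≤ 1 := fun a => by
    simpa using ENNReal.toReal_mono ENNReal.one_ne_top (hT a)
  have sumT : ∀ Z : PMF α, Summable fun a => (Z a).toReal * (T a).toReal := fun Z =>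
    (sumX Z).of_nonneg_of_le (fun a => by positivity) fun a =>
      mul_le_of_le_one_right ENNReal.toReal_nonneg (hT1 a)
  have eT : ∀ Z : PMF α, ex Z T = ENNReal.ofReal (∑' a, (Z a).toReal * (T a).toReal) := fun Z => by
    rw [ENNReal.ofReal_tsum_of_nonneg (fun a => by positivity) (sumT Z)]
    refine tsum_congr fun a => ?_
    rw [← ENNReal.toReal_mul, ENNReal.ofReal_toReal (ENNReal.mul_ne_top (Z.apply_ne_top a) (hT0 a))]
  have nn : ∀ Z : PMF α, 0 ≤ ∑' a, (Z a).toReal * (T a).toReal := fun Z =>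
    tsum_nonneg fun a => by positivity
  have sumA : Summable fun a => |(X a).toReal - (Y a).toReal| := ((sumX X).sub (sumX Y)).abs
  rw [eT, eT, ← ENNReal.ofReal_add (nn Y) (by rw [statDist]; positivity)]
  refine ENNReal.ofReal_le_ofReal ?_
  rw [← sub_le_iff_le_add', ← (sumT X).tsum_sub (sumT Y), statDist, ← tsum_mul_left]
  -- Both distributions have mass one, so `T` may be replaced by `T - 1/2`, whose absolute value is
  -- at most `1/2`. This yields the factor `1/2` in the statistical distance.
  have h0 : ∑' a, ((X a).toReal - (Y a).toReal) * (1 / 2) = 0 := by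
    rw [tsum_mul_right, (sumX X).tsum_sub (sumX Y), one, one, sub_self, zero_mul]
  rw [← sub_zero (∑' a, _), ← h0,
    ← ((sumT X).sub (sumT Y)).tsum_sub (((sumX X).sub (sumX Y)).mul_right _)]
  refine Summable.tsum_le_tsum (fun a => ?_)
    (((sumT X).sub (sumT Y)).sub (((sumX X).sub (sumX Y)).mul_right _)) (sumA.mul_left _)
  have h1 := hT1 a
  have h2 : 0 ≤ (T a).toReal := ENNReal.toReal_nonneg
  have h3 := le_abs_self ((X a).toReal - (Y a).toReal)
  have h4 := neg_abs_le ((X a).toReal - (Y a).toReal)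
  nlinarith

/-! ## Uniform strings -/

theorem uniformBits_apply (l : ℕ) (u : List Bool) :
    uniformBits l u = if u.length = l then ((2 : ℝ≥0∞) ^ l)⁻¹ else 0 := by
  rw [uniformBits, PMF.map_apply]
  split_ifs with h
  · subst h
    rw [tsum_eq_single u.get]
    · rw [if_pos (List.ofFn_get u).symm, PMF.uniformOfFintype_apply]
      simp
    · intro f hf
      rw [if_neg]
      intro e
      refine hf (List.ofFn_injective ?_)
      rw [← e, List.ofFn_get]
  · refine ENNReal.tsum_eq_zero.2 fun f => if_neg ?_
    rintro rfl
    simp at h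

theorem length_of_mem_uniformBits {l : ℕ} {u : List Bool} (h : u ∈ (uniformBits l).support) :
    u.length = l := by
  rw [PMF.mem_support_iff, uniformBits_apply] at h
  by_contra h'
  exact h (if_neg h')

theorem uniformBits_add (a b : ℕ) : uniformBits (a + b) =
    (uniformBits a).bind fun l => (uniformBits b).map fun m => l ++ m := by
  ext u
  rw [PMF.bind_apply, tsum_eq_single (u.take a)]
  · rw [PMF.map_apply, tsum_eq_single (u.drop a)]
    · simp only [List.take_append_drop, if_true, uniformBits_apply]
      by_cases h : u.length = a + b
      · rw [if_pos h, if_pos (by simp; omega), if_pos (by simp; omega), pow_add,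
          ENNReal.mul_inv (by simp) (by simp)]
      · rw [if_neg h]
        by_cases h1 : (u.take a).length = a
        · rw [if_neg (c := (u.drop a).length = b), mul_zero]
          simp at h1 ⊢
          omega
        · rw [if_neg h1, zero_mul]
    · intro m hm
      rw [if_neg]
      intro e
      exact hm (List.append_cancel_left ((List.take_append_drop a u).trans e)).symm
  · intro l hl
    by_cases h : l.length = a
    · rw [PMF.map_apply, ENNReal.tsum_eq_zero.2, mul_zero]
      intro m
      rw [if_neg]
      rintro rfl
      exact hl (by simp [← h])
    · rw [uniformBits_apply, if_neg h, zero_mul]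

/-- `h` consumes `N` uniform bits from its argument in order to sample from `μ`, and leaves the
remaining bits. -/
def Samples {α : Type} (h : List Bool → α × List Bool) (μ : PMF α) (N : ℕ) : Prop :=
  ∀ M, (uniformBits (N + M)).map h = μ.bind fun a => (uniformBits M).map fun ρ => (a, ρ)

theorem uniformBits_map_take {c B : ℕ} (h : c ≤ B) :
    (uniformBits B).map (List.take c) = uniformBits c := by
  obtain ⟨d, rfl⟩ := Nat.exists_eq_add_of_le h
  rw [uniformBits_add, PMF.map_bind]
  conv_rhs => rw [← PMF.bind_pure (uniformBits c)]
  refine pmf_bind_congr _ fun l hl => ?_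
  rw [PMF.map_comp, ← PMF.map_const (uniformBits d) l]
  congr 1
  funext m
  have := length_of_mem_uniformBits hl
  simp [← this]

namespace Samples

variable {α β γ : Type}

/-- Only `c` bits are used, but a whole block of `B` is discarded. Consumption thus stays constant
even when the number of coins needed depends on earlier results. -/
theorem of_take {c B : ℕ} (h : c ≤ B) (f : List Bool → α) :
    Samples (fun ρ => (f (ρ.take c), ρ.drop B)) ((uniformBits c).map f) B := by
  intro M
  rw [uniformBits_add, PMF.map_bind, ← uniformBits_map_take h, PMF.map_comp, PMF.bind_map]
  refine pmf_bind_congr _ fun l hl => ?_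
  rw [PMF.map_comp]
  congr 1
  funext m
  have hl := length_of_mem_uniformBits hl
  simp [← hl, List.take_append_of_le_length (hl.symm ▸ h : c ≤ l.length)]

theorem pure (a : α) : Samples (fun ρ => (a, ρ)) (PMF.pure a) 0 := by
  intro M
  rw [PMF.pure_bind, zero_add]

/-- The unused bits are again uniform and independent of the first sample, so the second sampler may
use them. Its consumption `N'` must be the same for all values `a`. -/
theorem bind {h : List Bool → α × List Bool} {g : α → List Bool → β × List Bool} {μ : PMF α}
    {ν : α → PMF β} {N N' : ℕ} (hh : Samples h μ N) (hg : ∀ a ∈ μ.support, Samples (g a) (ν a) N') :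
    Samples (fun ρ => g (h ρ).1 (h ρ).2) (μ.bind ν) (N + N') := by
  intro M
  have := congrArg (PMF.map fun p => g p.1 p.2) (hh (N' + M))
  rw [PMF.map_comp] at this
  rw [add_assoc]
  refine this.trans ?_
  rw [PMF.map_bind, PMF.bind_bind]
  refine pmf_bind_congr _ fun a ha => ?_
  rw [← hg a ha M, PMF.map_comp]
  rfl

theorem map {h : List Bool → α × List Bool} {μ : PMF α} {N : ℕ} (hh : Samples h μ N) (f : α → β) :
    Samples (fun ρ => (f (h ρ).1, (h ρ).2)) (μ.map f) N :=
  hh.bind (N' := 0) fun a _ => Samples.pure (f a)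

/-- Surplus coins are harmless. This matters because the numbers of coins are polynomials in the
size of an encoding, which exceeds the length of the string. -/
theorem dist {h : List Bool → α × List Bool} {μ : PMF α} {N C : ℕ} (hh : Samples h μ N)
    (hC : N ≤ C) : (uniformBits C).map (fun ρ => (h ρ).1) = μ := by
  obtain ⟨M, rfl⟩ := Nat.exists_eq_add_of_le hC
  have := congrArg (PMF.map Prod.fst) (hh M)
  rw [PMF.map_comp] at this
  refine this.trans ?_
  rw [PMF.map_bind]
  conv_rhs => rw [← PMF.bind_pure μ]
  congr 1
  funext a
  rw [PMF.map_comp]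
  exact PMF.map_const _ _

end Samples

/-- Iterate a randomized step over a list. -/
noncomputable def foldP {σ γ : Type} (step : σ → γ → PMF σ) : List γ → σ → PMF σ
  | [], s => PMF.pure s
  | x :: l, s => (step s x).bind (foldP step l)

theorem Samples.foldl {σ γ : Type} {h : σ × List Bool → γ → σ × List Bool} {step : σ → γ → PMF σ}
    {N : ℕ} (l : List γ) (hh : ∀ s, ∀ x ∈ l, Samples (fun ρ => h (s, ρ) x) (step s x) N) (s : σ) :
    Samples (fun ρ => l.foldl h (s, ρ)) (foldP step l s) (l.length * N) := by
  induction l generalizing s with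
  | nil => simpa [foldP] using Samples.pure s
  | cons x l ih =>
    rw [List.length_cons, add_mul, one_mul, add_comm]
    exact (hh s x (by simp)).bind fun s' _ => ih (fun s x hx => hh s x (by simp [hx])) s'

/-! ## Selecting the best of several samples by repeated trials -/

section Selection

theorem ex_comm {α β : Type*} (μ : PMF α) (ν : PMF β) (f : α → β → ℝ≥0∞) :
    ex μ (fun a => ex ν (f a)) = ex ν fun b => ex μ fun a => f a b := by
  simp only [ex, ← ENNReal.tsum_mul_left]
  rw [ENNReal.tsum_comm]
  exact tsum_congr fun b => tsum_congr fun a => by ring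

theorem ex_bool (w : PMF Bool) (f : Bool → ℝ≥0∞) : ex w f = w true * f true + w false * f false := by
  rw [ex, tsum_bool, add_comm]

theorem pmf_bool_add (w : PMF Bool) : w true + w false = 1 := by
  have := w.tsum_coe
  rwa [tsum_bool, add_comm] at this

/-- A potential that rises by at most `δ` in expectation at each step rises by at most `δ` times the
number of steps. -/
theorem ex_foldP_le {σ γ : Type} {step : σ → γ → PMF σ} {φ : σ → ℝ≥0∞} {δ : ℝ≥0∞} (l : List γ)
    (h : ∀ s, ∀ x ∈ l, ex (step s x) φ ≤ φ s + δ) (s : σ) :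
    ex (foldP step l s) φ ≤ φ s + l.length * δ := by
  induction l generalizing s with
  | nil => simp [foldP, ex_pure]
  | cons x l ih =>
    rw [foldP, ex_bind]
    calc _ ≤ ex (step s x) fun s' => φ s' + l.length * δ :=
          ex_mono _ fun s' _ => ih (fun s x hx => h s x (by simp [hx])) s'
      _ ≤ φ s + δ + l.length * δ := by
          rw [ex_add, ex_const]
          gcongr
          exact h s x (by simp)
      _ = _ := by
          push_cast [List.length_cons]
          ring

/-- The number of successes in `m` independent trials. -/
noncomputable def successes (w : PMF Bool) (m : ℕ) : PMF ℕ :=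
  foldP (fun c (_ : Unit) => w.map fun b => if b then c + 1 else c) (List.replicate m ()) 0

theorem successes_le {w : PMF Bool} {m c : ℕ} (h : c ∈ (successes w m).support) : c ≤ m := by
  have key : ∀ c₀, c ∈ (foldP (fun c (_ : Unit) => w.map fun b => if b then c + 1 else c)
      (List.replicate m ()) c₀).support → c ≤ c₀ + m := by
    clear h
    induction m with
    | zero =>
      intro c₀ h
      simp only [List.replicate_zero, foldP, PMF.support_pure, Set.mem_singleton_iff] at h
      omega
    | succ m ih =>
      intro c₀ h
      rw [List.replicate_succ, foldP, PMF.mem_support_bind_iff] at h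
      obtain ⟨c₁, h1, h2⟩ := h
      have := ih c₁ h2
      rw [PMF.support_map] at h1
      obtain ⟨b, -, rfl⟩ := h1
      cases b <;> simp at this <;> omega
  simpa using key 0 h

theorem ex_successes (w : PMF Bool) (m : ℕ) :
    ex (successes w m) (fun c => (c : ℝ≥0∞)) = m * w true := by
  have key : ∀ c₀ : ℕ, ex (foldP (fun c (_ : Unit) => w.map fun b => if b then c + 1 else c)
      (List.replicate m ()) c₀) (fun c => (c : ℝ≥0∞)) = c₀ + m * w true := by
    induction m with
    | zero => simp [foldP, ex_pure]
    | succ m ih =>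
      intro c₀
      rw [List.replicate_succ, foldP, ex_bind]
      simp only [ih]
      rw [ex_add, ex_const, ex_map, ex_bool]
      have := pmf_bool_add w
      calc _ = (w true + w false) * c₀ + w true + m * w true := by
            simp only [Bool.false_eq_true, if_true, if_false]
            push_cast
            ring
        _ = _ := by
            rw [this]
            push_cast
            ring
  simpa [successes] using key 0

/-- The variance of a binomial variable is `m q (1 - q) ≤ m / 4`. -/
theorem ex_successes_sq (w : PMF Bool) (m : ℕ) :
    ex (successes w m) (fun c => ENNReal.ofReal (((c : ℝ) - m * (w true).toReal) ^ 2)) ≤ m * 4⁻¹ := by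
  have ht : w true ≠ ⊤ := w.apply_ne_top _
  have hf : w false ≠ ⊤ := w.apply_ne_top _
  have hsum : (w true).toReal + (w false).toReal = 1 := by
    rw [← ENNReal.toReal_add ht hf, pmf_bool_add, ENNReal.toReal_one]
  -- The shift `u` lets the induction move the centre by `q` with every trial. The cross term
  -- vanishes because a trial has mean `q`, and its own variance is at most `1/4` by `(2q - 1) ^ 2 ≥
  -- 0`.
  have key : ∀ (c₀ : ℕ) (u : ℝ), ex (foldP (fun c (_ : Unit) => w.map fun b => if b then c + 1 else c)
      (List.replicate m ()) c₀) (fun c => ENNReal.ofReal (((c : ℝ) - u - m * (w true).toReal) ^ 2)) ≤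
        ENNReal.ofReal ((c₀ - u) ^ 2) + m * 4⁻¹ := by
    induction m with
    | zero => simp [foldP, ex_pure]
    | succ m ih =>
      intro c₀ u
      rw [List.replicate_succ, foldP, ex_bind]
      have h1 : ∀ c : ℕ, (c : ℝ) - u - ((m + 1 : ℕ) : ℝ) * (w true).toReal =
          c - (u + (w true).toReal) - m * (w true).toReal := fun c => by push_cast; ring
      simp only [h1]
      refine (ex_mono _ fun c _ => ih c (u + (w true).toReal)).trans ?_
      rw [ex_add, ex_const, ex_map, ex_bool]
      simp only [Bool.false_eq_true, if_true, if_false]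
      have h2 : w true * ENNReal.ofReal ((((c₀ + 1 : ℕ) : ℝ) - (u + (w true).toReal)) ^ 2) +
          w false * ENNReal.ofReal (((c₀ : ℝ) - (u + (w true).toReal)) ^ 2) ≤
          ENNReal.ofReal ((c₀ - u) ^ 2) + 4⁻¹ := by
        have h4 : (4⁻¹ : ℝ≥0∞) = ENNReal.ofReal (4⁻¹ : ℝ) := by
          rw [ENNReal.ofReal_inv_of_pos (by norm_num)]
          norm_num
        rw [← ENNReal.ofReal_toReal ht, ← ENNReal.ofReal_toReal hf, h4,
          ← ENNReal.ofReal_mul ENNReal.toReal_nonneg, ← ENNReal.ofReal_mul ENNReal.toReal_nonneg,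
          ← ENNReal.ofReal_add (by positivity) (by positivity),
          ← ENNReal.ofReal_add (by positivity) (by positivity),
          ENNReal.toReal_ofReal ENNReal.toReal_nonneg]
        refine ENNReal.ofReal_le_ofReal ?_
        generalize (w true).toReal = a at *
        rw [show (w false).toReal = 1 - a by linarith]
        push_cast
        nlinarith [sq_nonneg (2 * a - 1)]
      refine (add_le_add_left h2 _).trans (le_of_eq ?_)
      push_cast
      ring
  simpa [successes] using key 0 0

/-- With `s ^ 2` trials the standard deviation is at most `s / 2`. Instead of Cauchy-Schwarz, `d ≤ d
^ 2 / (2s) + s / 2` is used, which gives `s / 8 + s / 2 ≤ s`. -/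
theorem ex_successes_sub_le (w : PMF Bool) {s : ℕ} (hs : 0 < s) :
    ex (successes w (s ^ 2)) (fun c => (c : ℝ≥0∞) - (s ^ 2 : ℕ) * w true) ≤ s := by
  have ht : w true ≠ ⊤ := w.apply_ne_top _
  have hs' : (0 : ℝ) < s := by exact_mod_cast hs
  have h1 : ∀ c : ℕ, (c : ℝ≥0∞) - (s ^ 2 : ℕ) * w true ≤ ENNReal.ofReal (2 * s)⁻¹ *
      ENNReal.ofReal (((c : ℝ) - (s ^ 2 : ℕ) * (w true).toReal) ^ 2) + ENNReal.ofReal (s / 2) := by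
    intro c
    have h2 : (c : ℝ≥0∞) - (s ^ 2 : ℕ) * w true =
        ENNReal.ofReal ((c : ℝ) - (s ^ 2 : ℕ) * (w true).toReal) := by
      rw [ENNReal.ofReal_sub _ (by positivity), ENNReal.ofReal_mul (by positivity),
        ENNReal.ofReal_toReal ht, ENNReal.ofReal_natCast, ENNReal.ofReal_natCast]
    rw [h2, ← ENNReal.ofReal_mul (by positivity), ← ENNReal.ofReal_add (by positivity) (by positivity)]
    refine ENNReal.ofReal_le_ofReal ?_
    generalize (c : ℝ) - (s ^ 2 : ℕ) * (w true).toReal = d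
    have : (2 * (s : ℝ))⁻¹ * d ^ 2 + s / 2 - d = (2 * (s : ℝ))⁻¹ * (d - s) ^ 2 := by
      field_simp
      ring
    have h3 : 0 ≤ (2 * (s : ℝ))⁻¹ * (d - s) ^ 2 := by positivity
    linarith
  refine (ex_mono _ fun c _ => h1 c).trans ?_
  rw [ex_add, ex_const, ex_mul_left]
  refine (add_le_add_left (mul_le_mul_right (ex_successes_sq w (s ^ 2)) _) _).trans ?_
  have h4 : ((s ^ 2 : ℕ) : ℝ≥0∞) * 4⁻¹ = ENNReal.ofReal (s ^ 2 * 4⁻¹) := by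
    rw [ENNReal.ofReal_mul (by positivity), ENNReal.ofReal_inv_of_pos (by norm_num),
      ← Nat.cast_pow, ENNReal.ofReal_natCast]
    norm_num
  rw [h4, ← ENNReal.ofReal_mul (by positivity), ← ENNReal.ofReal_add (by positivity) (by positivity),
    ← ENNReal.ofReal_natCast]
  refine ENNReal.ofReal_le_ofReal ?_
  have : (2 * (s : ℝ))⁻¹ * (s ^ 2 * 4⁻¹) = s / 8 := by
    field_simp
    norm_num
  rw [this]
  linarith

/-- `k` independent samples. -/
noncomputable def iid {α : Type} (μ : PMF α) (k : ℕ) : PMF (List α) :=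
  foldP (fun acc (_ : Unit) => μ.map fun z => z :: acc) (List.replicate k ()) []

theorem length_of_mem_iid {α : Type} {μ : PMF α} {k : ℕ} {l : List α} (h : l ∈ (iid μ k).support) :
    l.length = k := by
  have key : ∀ acc, l ∈ (foldP (fun acc (_ : Unit) => μ.map fun z => z :: acc)
      (List.replicate k ()) acc).support → l.length = acc.length + k := by
    clear h
    induction k with
    | zero =>
      intro acc h
      simp only [List.replicate_zero, foldP, PMF.support_pure, Set.mem_singleton_iff] at h
      simp [h]
    | succ k ih =>
      intro acc h
      rw [List.replicate_succ, foldP, PMF.mem_support_bind_iff] at h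
      obtain ⟨c₁, h1, h2⟩ := h
      have := ih c₁ h2
      rw [PMF.support_map] at h1
      obtain ⟨b, -, rfl⟩ := h1
      rw [this, List.length_cons]
      omega
  simpa using key [] h

/-- Independence: expectations of products factor. -/
theorem ex_iid_prod {α : Type} (μ : PMF α) (k : ℕ) (g : α → ℝ≥0∞) :
    ex (iid μ k) (fun l => (l.map g).prod) = ex μ g ^ k := by
  have key : ∀ acc, ex (foldP (fun acc (_ : Unit) => μ.map fun z => z :: acc)
      (List.replicate k ()) acc) (fun l => (l.map g).prod) = ex μ g ^ k * (acc.map g).prod := by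
    induction k with
    | zero => simp [foldP, ex_pure]
    | succ k ih =>
      intro acc
      rw [List.replicate_succ, foldP, ex_bind, ex_map]
      simp only [ih, List.map_cons, List.prod_cons]
      rw [ex_mul_left, ex_mul_right]
      ring
  simpa [iid] using key []

variable (vd : List Bool → PMF Bool) (prf : List Bool → List Bool) (m : ℕ)

/-- One round of the selection: try the candidate `prf z` and keep it if it beats the best one so
far. -/
noncomputable def challenge (s : List Bool × ℕ) (z : List Bool) : PMF (List Bool × ℕ) :=
  (successes (vd (prf z)) m).map fun c => if s.2 < c then (prf z, c) else s

/-- The candidate with the largest number of successes and this number. -/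
noncomputable def best (zs : List (List Bool)) : PMF (List Bool × ℕ) :=
  foldP (challenge vd prf m) zs ([], 0)

/-- The best count stays below `j` exactly when the initial count and the counts of all candidates
do, and the trials of different candidates are independent. -/
theorem ex_best_lt (zs : List (List Bool)) (j : ℕ) :
    ex (best vd prf m zs) (fun s => ind (s.2 < j)) ≤
      (zs.map fun z => ex (successes (vd (prf z)) m) fun c => ind (c < j)).prod := by
  have key : ∀ s : List Bool × ℕ, ex (foldP (challenge vd prf m) zs s) (fun s => ind (s.2 < j)) =
      ind (s.2 < j) *
        (zs.map fun z => ex (successes (vd (prf z)) m) fun c => ind (c < j)).prod := by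
    induction zs with
    | nil => simp [foldP, ex_pure]
    | cons z zs ih =>
      intro s
      rw [foldP, ex_bind, challenge, ex_map]
      simp only [ih]
      rw [ex_mul_right, List.map_cons, List.prod_cons, ← mul_assoc, ← ex_mul_left]
      congr 2
      funext c
      by_cases h : s.2 < c
      · rw [if_pos h]
        by_cases h' : c < j
        · rw [ind_true (p := s.2 < j) (by omega), one_mul]
        · rw [ind_false (p := (prf z, c).2 < j) h', mul_zero]
      · rw [if_neg h]
        by_cases h' : s.2 < j
        · rw [ind_true h', ind_true (p := c < j) (by omega), one_mul]
        · rw [ind_false h', zero_mul]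
  rw [best, key]
  exact mul_le_of_le_one_left zero_le (ind_le_one _)

/-- Control of the selection bias. The potential is the positive part of the winner's count minus
its expected count. Each candidate raises it by at most its own excess, whose mean is at most `s`,
so a maximum over the candidates costs no more than the sum. -/
theorem ex_best_count_le {s : ℕ} (hs : 0 < s) (zs : List (List Bool)) :
    ex (best vd prf (s ^ 2) zs) (fun b => (b.2 : ℝ≥0∞)) ≤
      (s ^ 2 : ℕ) * ex (best vd prf (s ^ 2) zs) (fun b => vd b.1 true) + zs.length * s := by
  have h1 : ex (best vd prf (s ^ 2) zs) (fun b => (b.2 : ℝ≥0∞) - (s ^ 2 : ℕ) * vd b.1 true) ≤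
      zs.length * s := by
    refine (ex_foldP_le (δ := s) zs (fun b z _ => ?_) _).trans (by simp)
    rw [challenge, ex_map]
    -- Whichever of the two candidates is kept, its excess is one of the two summands.
    calc _ ≤ ex (successes (vd (prf z)) (s ^ 2)) fun c => ((b.2 : ℝ≥0∞) - (s ^ 2 : ℕ) * vd b.1 true) +
          ((c : ℝ≥0∞) - (s ^ 2 : ℕ) * vd (prf z) true) := ex_mono _ fun c _ => by
            split_ifs
            · exact le_add_self
            · exact le_self_add
      _ ≤ _ := by
        rw [ex_add, ex_const]
        gcongr
        exact ex_successes_sub_le _ hs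
  rw [← ex_mul_left]
  calc _ ≤ ex (best vd prf (s ^ 2) zs) (fun b => (s ^ 2 : ℕ) * vd b.1 true +
        ((b.2 : ℝ≥0∞) - (s ^ 2 : ℕ) * vd b.1 true)) := ex_mono _ fun b _ => le_add_tsub
    _ ≤ _ := by
      rw [ex_add]
      gcongr

variable (inv : PMF (List Bool)) (k : ℕ)

/-- The best of `k` independent candidates. -/
noncomputable def selection : PMF (List Bool × ℕ) := (iid inv k).bind (best vd prf m)

/-- The probability that a candidate strictly beats the best of `k` independent candidates. -/
noncomputable def beats (π : List Bool) : ℝ≥0∞ :=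
  ex (selection vd prf m inv k) fun b => ex (successes (vd π) m) fun c => ind (b.2 < c)

/-- Comparison with an arbitrary rival `π`. Its count is at most the winner's count unless it wins,
and then at most the number `s ^ 2` of trials. Taking means, bounding the winner's bias and dividing
by `s ^ 2` gives the claim. -/
theorem accept_le_selection {s : ℕ} (hs : 0 < s) (π : List Bool) :
    vd π true ≤ ex (selection vd prf (s ^ 2) inv k) (fun b => vd b.1 true) + k / s +
      beats vd prf (s ^ 2) inv k π := by
  have hs0 : (s : ℝ≥0∞) ≠ 0 := by exact_mod_cast hs.ne'
  have hst : (s : ℝ≥0∞) ≠ ⊤ := ENNReal.natCast_ne_top s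
  have hm0 : ((s ^ 2 : ℕ) : ℝ≥0∞) ≠ 0 := by exact_mod_cast (pow_pos hs 2).ne'
  have hmt : ((s ^ 2 : ℕ) : ℝ≥0∞) ≠ ⊤ := ENNReal.natCast_ne_top _
  rw [← ENNReal.mul_le_mul_iff_right hm0 hmt, ← ex_successes]
  have h1 : ex (selection vd prf (s ^ 2) inv k) (fun b => (b.2 : ℝ≥0∞)) ≤
      (s ^ 2 : ℕ) * ex (selection vd prf (s ^ 2) inv k) (fun b => vd b.1 true) + k * s := by
    rw [selection, ex_bind, ex_bind, ← ex_mul_left, ← ex_const (iid inv k) (k * s : ℝ≥0∞),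
      ← ex_add]
    refine ex_mono _ fun zs hzs => (ex_best_count_le vd prf hs zs).trans ?_
    rw [length_of_mem_iid hzs]
  calc ex (successes (vd π) (s ^ 2)) (fun c => (c : ℝ≥0∞))
      ≤ ex (selection vd prf (s ^ 2) inv k) fun b => ex (successes (vd π) (s ^ 2)) fun c =>
        ((b.2 : ℝ≥0∞) + (s ^ 2 : ℕ) * ind (b.2 < c)) := by
        rw [← ex_const (selection vd prf (s ^ 2) inv k) (ex (successes (vd π) (s ^ 2)) _)]
        refine ex_mono _ fun b _ => ex_mono _ fun c hc => ?_
        by_cases h : b.2 < c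
        · rw [ind_true h, mul_one]
          refine le_trans ?_ le_add_self
          exact_mod_cast successes_le hc
        · rw [ind_false h, mul_zero, add_zero]
          exact_mod_cast not_lt.1 h
    _ = ex (selection vd prf (s ^ 2) inv k) (fun b => (b.2 : ℝ≥0∞)) +
        (s ^ 2 : ℕ) * beats vd prf (s ^ 2) inv k π := by
        simp only [ex_add, ex_const, ex_mul_left, beats]
    _ ≤ (s ^ 2 : ℕ) * ex (selection vd prf (s ^ 2) inv k) (fun b => vd b.1 true) + k * s +
        (s ^ 2 : ℕ) * beats vd prf (s ^ 2) inv k π := by gcongr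
    _ = _ := by
        rw [mul_add, mul_add]
        congr 2
        push_cast
        rw [pow_two, mul_assoc, ENNReal.mul_div_cancel hs0 hst, mul_comm]

theorem pow_succ_add_le (F q : ℝ≥0∞) (k : ℕ) :
    F ^ (k + 1) + (k + 1) * (q * F ^ k) ≤ (F + q) ^ (k + 1) := by
  induction k with
  | zero => simp
  | succ k ih =>
    calc _ ≤ (F ^ (k + 1) + (k + 1) * (q * F ^ k)) * (F + q) := by
          have : (F ^ (k + 1) + (k + 1) * (q * F ^ k)) * (F + q) =
              F ^ (k + 1 + 1) + ((k + 1 : ℕ) + 1) * (q * F ^ (k + 1)) +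
                (k + 1) * (q * F ^ k) * q := by
            push_cast
            ring
          rw [this]
          exact le_self_add
      _ ≤ (F + q) ^ (k + 1) * (F + q) := by gcongr
      _ = _ := (pow_succ _ _).symm

/-- A variable strictly exceeds `k` independent copies of itself with probability at most `1 / (k +
1)`: a discrete form of `∫ F ^ k dF = 1 / (k + 1)`. The inequality is strict, so ties only help. -/
theorem ex_cdf_pow_le (Q : PMF ℕ) (k : ℕ) :
    ex Q (fun j => ex Q (fun c => ind (c < j)) ^ k) ≤ (k + 1 : ℝ≥0∞)⁻¹ := by
  have hF : ∀ j, ex Q (fun c => ind (c < j + 1)) = ex Q (fun c => ind (c < j)) + Q j := by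
    intro j
    rw [← ex_ind_eq Q j, ← ex_add]
    congr 1
    funext c
    rcases lt_trichotomy c j with h | h | h
    · rw [ind_true (p := c < j + 1) (by omega), ind_true h, ind_false h.ne, add_zero]
    · rw [ind_true (p := c < j + 1) (by omega), ind_false h.not_lt, ind_true h, zero_add]
    · rw [ind_false (p := c < j + 1) (by omega), ind_false (p := c < j) (by omega),
        ind_false h.ne', add_zero]
  rw [ENNReal.le_inv_iff_mul_le, ex, ← ENNReal.tsum_mul_right,
    ENNReal.tsum_eq_iSup_nat]
  refine iSup_le fun n => ?_
  -- The partial sums are bounded by `F(n) ^ (k + 1)`, where `F(n)` is the probability of a value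
  -- below `n`; by `F(j + 1) = F(j) + Q(j)` and `pow_succ_add_le` the bound telescopes.
  suffices ∑ j ∈ Finset.range n, Q j * ex Q (fun c => ind (c < j)) ^ k * (k + 1) ≤
      ex Q (fun c => ind (c < n)) ^ (k + 1) from
    this.trans (pow_le_one' (ex_le_one _ fun c => ind_le_one _) _)
  induction n with
  | zero => simp
  | succ n ih =>
    rw [Finset.sum_range_succ, hF]
    refine le_trans ?_ (pow_succ_add_le _ _ k)
    refine add_le_add ih (le_of_eq ?_)
    ring

/-- A further independent candidate beats the best of `k` with probability at most
`1 / (k + 1)`. -/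
theorem ex_beats_le : ex inv (fun z => beats vd prf m inv k (prf z)) ≤ (k + 1 : ℝ≥0∞)⁻¹ := by
  -- The common law of all counts: a candidate is drawn and then tried `m` times.
  refine le_trans ?_ (ex_cdf_pow_le (inv.bind fun z => successes (vd (prf z)) m) k)
  rw [ex_bind]
  refine ex_mono _ fun z _ => ?_
  rw [beats, ex_comm]
  refine ex_mono _ fun j _ => ?_
  rw [ex_bind, ← ex_iid_prod, selection, ex_bind]
  exact ex_mono _ fun zs _ => ex_best_lt vd prf m zs j

end Selection

/-! ## Programs with oracle queries -/

/-- `a` halts within `T` steps, and its output is distributed as `D`. -/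
def Yields (a : PMF (Option (Data × ℕ))) (D : PMF Data) (T : ℕ) : Prop :=
  a.map (Option.map Prod.fst) = D.map some ∧ ∀ o ∈ a.support, ∃ d t, o = some (d, t) ∧ t ≤ T

theorem Yields.mono {a : PMF (Option (Data × ℕ))} {D : PMF Data} {S T : ℕ} (h : Yields a D S)
    (hT : S ≤ T) : Yields a D T :=
  ⟨h.1, fun o ho => by
    obtain ⟨d, t, rfl, ht⟩ := h.2 o ho
    exact ⟨d, t, rfl, ht.trans hT⟩⟩

theorem Yields.pure {d : Data} {t T : ℕ} (h : t ≤ T) :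
    Yields (Pure.pure (some (d, t))) (PMF.pure d) T := by
  change Yields (PMF.pure (some (d, t))) _ _
  refine ⟨?_, fun o ho => ⟨d, t, by simpa using ho, h⟩⟩
  rw [PMF.pure_map, PMF.pure_map]
  rfl

theorem Yields.tick {a : PMF (Option (Data × ℕ))} {D : PMF Data} {T : ℕ} (h : Yields a D T)
    (n : ℕ) : Yields (NIZK.tick n a) D (n + T) := by
  have e : NIZK.tick n a = a.map (Option.map fun r => (r.1, n + r.2)) := rfl
  rw [e]
  constructor
  · rw [PMF.map_comp, ← h.1]
    congr 1
    funext o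
    cases o <;> rfl
  · intro o ho
    rw [PMF.support_map] at ho
    obtain ⟨o', ho', rfl⟩ := ho
    obtain ⟨d, t, rfl, ht⟩ := h.2 o' ho'
    exact ⟨d, n + t, rfl, by omega⟩

/-- The intermediate result is indexed by a typed value `z` instead of its encoding, so `E` is
defined on values and `φ` need not be inverted. -/
theorem Yields.andThen_map {a : PMF (Option (Data × ℕ))} {β : Type} {μ : PMF β} {φ : β → Data}
    {S T : ℕ} (h : Yields a (μ.map φ) S) {f : Data → PMF (Option (Data × ℕ))} {E : β → PMF Data}
    (hf : ∀ z ∈ μ.support, Yields (f (φ z)) (E z) T) :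
    Yields (NIZK.andThen a f) (μ.bind E) (S + T) := by
  have e : NIZK.andThen a f = a.bind fun o => match o with
    | none => PMF.pure none
    | some r => NIZK.tick r.2 (f r.1) := rfl
  have mem : ∀ d t, some (d, t) ∈ a.support → ∃ z ∈ μ.support, φ z = d := by
    intro d t hd
    have : some d ∈ (a.map (Option.map Prod.fst)).support := by
      rw [PMF.support_map]
      exact ⟨_, hd, rfl⟩
    rw [h.1, PMF.support_map, PMF.support_map] at this
    obtain ⟨d', ⟨z, hz, rfl⟩, e⟩ := this
    exact ⟨z, hz, Option.some.inj e⟩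
  rw [e]
  constructor
  · have h1 := congrArg (fun m => m.bind fun o => match o with
      | none => PMF.pure none
      | some d => (f d).map (Option.map Prod.fst)) h.1
    simp only [PMF.bind_map] at h1
    rw [PMF.map_bind, PMF.map_bind]
    refine (pmf_bind_congr _ fun o ho => ?_).trans (h1.trans (pmf_bind_congr _ fun z hz => ?_))
    · obtain ⟨d, t, rfl, -⟩ := h.2 o ho
      obtain ⟨z, hz, rfl⟩ := mem d t ho
      exact ((hf z hz).tick t).1.trans (hf z hz).1.symm
    · exact (hf z hz).1
  · intro o ho
    rw [PMF.mem_support_bind_iff] at ho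
    obtain ⟨o', ho', ho⟩ := ho
    obtain ⟨d, t, rfl, ht⟩ := h.2 o' ho'
    obtain ⟨z, hz, rfl⟩ := mem d t ho'
    obtain ⟨d', t', rfl, ht'⟩ := ((hf z hz).tick t).2 o ho
    exact ⟨d', t', rfl, by omega⟩

theorem Yields.andThen {a : PMF (Option (Data × ℕ))} {D : PMF Data} {S T : ℕ} (h : Yields a D S)
    {f : Data → PMF (Option (Data × ℕ))} {E : Data → PMF Data}
    (hf : ∀ d ∈ D.support, Yields (f d) (E d) T) :
    Yields (NIZK.andThen a f) (D.bind E) (S + T) :=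
  Yields.andThen_map (φ := fun d => d) (by rwa [← PMF.map_id D] at h) hf

/-! ### Executing a batch of identical queries -/

section

variable (O : Data → PMF (List Bool))

/-- `c` halts on `v` within `T` steps, and its output is distributed as `D`. -/
def RunsP (c : Code) (v : Data) (D : PMF Data) (T : ℕ) : Prop :=
  ∀ k, T ≤ k → Yields (c.exec O k v) D T

variable {O}

theorem Runs.strip {c : Code} {v d : Data} {t T : ℕ} (h : Runs c v d t) (ht : t ≤ T) :
    RunsP O c.strip v (PMF.pure d) T := by
  intro k hk
  rw [exec_strip, h k (ht.trans hk)]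
  exact Yields.pure ht

theorem RunsP.mono {c : Code} {v : Data} {D : PMF Data} {S T : ℕ} (h : RunsP O c v D S)
    (hT : S ≤ T) : RunsP O c v D T := fun k hk => (h k (hT.trans hk)).mono hT

theorem RunsP.comp {f g : Code} {v : Data} {D : PMF Data} {E : Data → PMF Data} {S T : ℕ}
    (hf : RunsP O f v D S) (hg : ∀ d ∈ D.support, RunsP O g d (E d) T) :
    RunsP O (.comp g f) v (D.bind E) (v.size + (S + T)) := fun k hk =>
  ((hf k (by omega)).andThen fun d hd => hg d hd k (by omega)).tick v.size

theorem RunsP.pair {f g : Code} {v : Data} {D E : PMF Data} {S T : ℕ}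
    (hf : RunsP O f v D S) (hg : RunsP O g v E T) :
    RunsP O (.pair f g) v (D.bind fun a => E.bind fun b => PMF.pure (.pair a b))
      (v.size + (S + T)) := fun k hk =>
  ((hf k (by omega)).andThen fun _ _ =>
    (hg k (by omega)).andThen (T := 0) fun _ _ => Yields.pure le_rfl).tick v.size

theorem RunsP.query (v : Data) :
    RunsP O .query v ((O v.fst).map fun y => ofBits (y.take v.snd.size)) v.size := by
  intro k _
  have e : Code.query.exec O k v = (O v.fst).map fun y =>
    some (ofBits (y.take v.snd.size), v.size) := rfl
  rw [e]
  constructor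
  · rw [PMF.map_comp, PMF.map_comp]
    rfl
  · intro o ho
    rw [PMF.support_map] at ho
    obtain ⟨y, -, rfl⟩ := ho
    exact ⟨_, _, rfl, le_rfl⟩

/-- From `(n, (acc, (q, u)))` to `(n - 1, (z :: acc, (q, u)))`, where `z` is the answer to the
query `q`. -/
def gatherBody : Code := .pair (.comp .snd .fst)
  (.pair (.pair (.comp .query (.comp .snd .snd)) (.comp .fst .snd)) (.comp .snd .snd))

/-- From `(n, (acc, (q, u)))`, query `q` for `n` times and put the answers in front of the list
`acc`. -/
def gather : Code := .loop (.comp .isPair .fst) gatherBody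

theorem runsP_atomic {c : Code} {v d : Data} (h : ∀ k, c.exec₀ k v = some (d, v.size))
    (hc : c.strip = c) : RunsP O c v (PMF.pure d) v.size := by
  rw [← hc]
  exact Runs.strip (fun k _ => h k) le_rfl

theorem RunsP.comp_pure {f g : Code} {v a : Data} {D : PMF Data} {S T : ℕ}
    (hf : RunsP O f v (PMF.pure a) S) (hg : RunsP O g a D T) :
    RunsP O (.comp g f) v D (v.size + (S + T)) := by
  have := hf.comp (E := fun _ => D) (T := T) (g := g) fun d hd => by
    rw [PMF.support_pure, Set.mem_singleton_iff] at hd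
    exact hd ▸ hg
  rwa [PMF.pure_bind] at this

/-- Each answer is cut to `u.size` bits and so enlarges the state by at most `2 * u.size + 2`. Hence
the sum of the present size and the growth still possible never increases, and `M` bounds all states
to come. -/
theorem gather_yields (q u : Data) (k n M : ℕ) (acc : List (List Bool))
    (hM : sz (n, acc, q, u) + n * (2 * u.size + 2) ≤ M) (hk : (n + 1) * (22 * M) ≤ k) (j : ℕ)
    (hj : n < j) :
    Yields (whileLoop (Code.exec O k (.comp .isPair .fst)) (Code.exec O k gatherBody) j
        (enc (n, acc, q, u)))
      ((foldP (fun acc (_ : Unit) => ((O q).map (List.take u.size)).map fun z => z :: acc)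
        (List.replicate n ()) acc).map fun acc' => enc (0, acc', q, u)) ((n + 1) * (22 * M)) := by
  induction n generalizing acc j with
  | zero =>
    obtain ⟨j, rfl⟩ : ∃ i, j = i + 1 := ⟨j - 1, by omega⟩
    have h1 : RunsP O (.comp .isPair .fst) (enc (0, acc, q, u)) (PMF.pure (bit false)) _ :=
      (runsP_atomic (d := enc 0) (fun _ => rfl) rfl).comp_pure
        (runsP_atomic (c := .isPair) (fun _ => rfl) rfl)
    have e0 : sz (0, acc, q, u) = (enc (0, acc, q, u)).size := rfl
    have e1 : (enc 0).size = 1 := rfl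
    have e2 : (enc (0, acc, q, u)).size = 1 + (enc (acc, q, u)).size + 1 := rfl
    rw [e1] at h1
    have h2 := ((h1 k (by omega)).andThen (T := 0) (E := fun _ => PMF.pure (enc (0, acc, q, u)))
      (f := fun b => if b = bit true then NIZK.andThen (Code.exec O k gatherBody
        (enc (0, acc, q, u))) (whileLoop (Code.exec O k (.comp .isPair .fst))
          (Code.exec O k gatherBody) j) else
        Pure.pure (some (enc (0, acc, q, u), 0)))
      fun b hb => by
        rw [PMF.support_pure, Set.mem_singleton_iff] at hb
        rw [hb, if_neg (by simp)]
        exact Yields.pure le_rfl).tick (enc (0, acc, q, u)).size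
    rw [PMF.pure_bind] at h2
    simp only [List.replicate_zero, foldP, PMF.pure_map]
    exact h2.mono (by omega)
  | succ n ih =>
    obtain ⟨j, rfl⟩ : ∃ i, j = i + 1 := ⟨j - 1, by omega⟩
    set v := enc (n + 1, acc, q, u) with hv
    have e1 : v = .pair (.pair nil (enc n)) (.pair (enc acc) (.pair q u)) := rfl
    have e2 : v.size ≤ M := by
      have : sz (n + 1, acc, q, u) = v.size := rfl
      omega
    have b1 : v.fst.size ≤ v.size := by rw [e1]; simp only [Data.fst, Data.size]; omega
    have b2 : v.snd.size ≤ v.size := by rw [e1]; simp only [Data.snd, Data.size]; omega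
    have b3 : v.snd.snd.size ≤ v.size := by rw [e1]; simp only [Data.snd, Data.size]; omega
    have h1 : RunsP O (.comp .isPair .fst) v (PMF.pure (bit true)) _ :=
      (runsP_atomic (d := v.fst) (fun _ => rfl) rfl).comp_pure
        (runsP_atomic (c := .isPair) (fun _ => rfl) rfl)
    have h2 : RunsP O (.comp .snd .fst) v (PMF.pure (enc n)) _ :=
      (runsP_atomic (d := v.fst) (fun _ => rfl) rfl).comp_pure
        (runsP_atomic (c := .snd) (fun _ => rfl) rfl)
    have h3 : RunsP O (.comp .snd .snd) v (PMF.pure (.pair q u)) _ :=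
      (runsP_atomic (d := v.snd) (fun _ => rfl) rfl).comp_pure
        (runsP_atomic (c := .snd) (fun _ => rfl) rfl)
    have h4 : RunsP O (.comp .fst .snd) v (PMF.pure (enc acc)) _ :=
      (runsP_atomic (d := v.snd) (fun _ => rfl) rfl).comp_pure
        (runsP_atomic (c := .fst) (fun _ => rfl) rfl)
    have e3 : (Data.pair q u).size ≤ v.size := b3
    have h5 : RunsP O gatherBody v _ _ :=
      h2.pair (((h3.comp_pure (RunsP.query (.pair q u))).pair h4).pair h3)
    simp only [PMF.pure_bind, PMF.bind_map, Function.comp_def, PMF.bind_bind] at h5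
    -- The nodes of the body work on trees of size at most `M`, which adds up to `17 * M`. With the
    -- test and the loop's own charge a round stays within `22 * M`.
    have h5' : RunsP O gatherBody v (((O q).map (List.take u.size)).map
        fun z => enc (n, z :: acc, q, u)) (17 * M) := by
      have := h5.mono (T := 17 * M) (by omega)
      simp only [← enc_bits] at this
      rw [PMF.map_comp]
      exact this
    have hk' : (n + 1) * (22 * M) + 22 * M ≤ k := by
      rw [add_mul _ 1] at hk
      omega
    have h6 := (h1 k (by omega)).andThen (T := 18 * M + (n + 1) * (22 * M))
      (E := fun _ => ((foldP (fun acc (_ : Unit) => ((O q).map (List.take u.size)).map fun z => z :: acc)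
        (List.replicate (n + 1) ()) acc).map fun acc' => enc (0, acc', q, u)))
      (f := fun b => if b = bit true then NIZK.andThen (Code.exec O k gatherBody v)
        (whileLoop (Code.exec O k (.comp .isPair .fst)) (Code.exec O k gatherBody) j) else
        Pure.pure (some (v, 0)))
      fun b hb => by
        rw [PMF.support_pure, Set.mem_singleton_iff] at hb
        rw [hb, if_pos rfl]
        rw [List.replicate_succ, foldP, PMF.bind_map, PMF.map_bind]
        refine ((h5' k (by omega)).andThen_map (φ := fun z => enc (n, z :: acc, q, u))
          (T := (n + 1) * (22 * M)) fun z hz =>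
            ih (z :: acc) ?_ (by omega) j (by omega)).mono (by omega)
        rw [PMF.support_map] at hz
        obtain ⟨y, -, rfl⟩ := hz
        have e4 : sz (n, y.take u.size :: acc, q, u) + 2 =
            sz (n + 1, acc, q, u) + (2 * (y.take u.size).length + 1) + 1 := by
          simp only [sz_pair, sz_cons, sz_nat, sz_bits]
          ring
        have := List.length_take_le u.size y
        rw [add_mul, one_mul] at hM
        omega
    rw [PMF.pure_bind] at h6
    exact (h6.tick v.size).mono (by rw [add_mul (n + 1) 1]; omega)

theorem mem_of_mem_iid {α : Type} {μ : PMF α} {k : ℕ} {l : List α} (h : l ∈ (iid μ k).support) :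
    ∀ z ∈ l, z ∈ μ.support := by
  have key : ∀ acc : List α, (∀ z ∈ acc, z ∈ μ.support) →
      l ∈ (foldP (fun acc (_ : Unit) => μ.map fun z => z :: acc)
        (List.replicate k ()) acc).support → ∀ z ∈ l, z ∈ μ.support := by
    clear h
    induction k with
    | zero =>
      intro acc hacc h
      simp only [List.replicate_zero, foldP, PMF.support_pure, Set.mem_singleton_iff] at h
      rwa [h]
    | succ k ih =>
      intro acc hacc h
      rw [List.replicate_succ, foldP, PMF.mem_support_bind_iff] at h
      obtain ⟨c₁, h1, h2⟩ := h
      rw [PMF.support_map] at h1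
      obtain ⟨b, hb, rfl⟩ := h1
      exact ih _ (fun z hz => (List.mem_cons.1 hz).elim (fun e => e ▸ hb) (hacc z)) h2
  exact key [] (by simp) h

theorem sz_list_le {α : Type} [Enc α] (l : List α) {B : ℕ} (h : ∀ z ∈ l, sz z ≤ B) :
    sz l ≤ l.length * (B + 1) + 1 := by
  induction l with
  | nil => simp [sz_nil]
  | cons z l ih =>
    have h1 := ih fun z hz => h z (by simp [hz])
    have h2 := h z (by simp)
    rw [sz_cons, List.length_cons, add_mul]
    omega

/-- Compute the number `n` of queries, a query `q` and further data `u`, ask the query `n` times and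
process the answers. -/
theorem exists_oraclePPT {pre : Data → ℕ × Data × Data} {β : Type} [Enc β]
    {post : List (List Bool) × Data × Data → β}
    (hpre : Poly pre) (hpost : Poly post) (coins : Polynomial ℕ) :
    ∃ R : OraclePPT, R.coins = coins ∧ ∀ (O : Data → PMF (List Bool)) (v : Data),
      (R.code.exec O (R.time.eval v.size) v).map (Option.map Prod.fst) =
        (iid ((O (pre v).2.1).map (List.take (pre v).2.2.size)) (pre v).1).map
          fun zs => some (enc (post (zs, (pre v).2))) := by
  have hpre' : Poly fun v => ((pre v).1, ([] : List (List Bool)), (pre v).2) :=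
    hpre.fst.pair ((Poly.const _).pair hpre.snd)
  have hpost' : Poly fun s : ℕ × List (List Bool) × Data × Data => post s.2 :=
    hpost.comp Poly.id.snd
  have bn : PolyBd fun v => sz (pre v).1 := hpre.fst.bd
  have bu : PolyBd fun v => sz (pre v).2.2 := hpre.snd.snd.bd
  have bM : PolyBd fun v => sz ((pre v).1, ([] : List (List Bool)), (pre v).2) +
      sz (pre v).1 * (2 * sz (pre v).2.2 + 2) :=
    hpre'.bd.add (bn.mul (((PolyBd.const 2).mul bu).add (.const 2)))
  obtain ⟨c, S, bS, hc⟩ := hpre'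
  obtain ⟨d, U, ⟨q, hq⟩, hd⟩ := hpost'
  set M : Data → ℕ := fun v => sz ((pre v).1, ([] : List (List Bool)), (pre v).2) +
      sz (pre v).1 * (2 * sz (pre v).2.2 + 2) with hM
  obtain ⟨T, hT⟩ : PolyBd fun v : Data => sz v + ((sz v + (S v + (sz (pre v).1 + 1) * (22 * M v))) +
      q.eval (M v)) :=
    PolyBd.size.add ((PolyBd.size.add (bS.add ((bn.add (.const 1)).mul ((PolyBd.const 22).mul bM)))).add
      (bM.eval q))
  have key : ∀ (O : Data → PMF (List Bool)) (v : Data),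
      RunsP O (.comp d.strip (.comp gather c.strip)) v
        ((iid ((O (pre v).2.1).map (List.take (pre v).2.2.size)) (pre v).1).map
          fun zs => enc (post (zs, (pre v).2))) (T.eval v.size) := by
    intro O v
    obtain ⟨t, ht, h1⟩ := hc v
    obtain ⟨⟨n, w, u⟩, hp⟩ : ∃ p, pre v = p := ⟨_, rfl⟩
    have hTv := hT v
    have hMv : M v = sz (n, ([] : List (List Bool)), w, u) + sz n * (2 * sz u + 2) := by
      simp only [hM, hp]
    simp only [hp] at hTv h1 ⊢
    have hn : n ≤ sz n := by rw [sz_nat]; omega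
    have hle : n * (2 * u.size + 2) ≤ sz n * (2 * sz u + 2) := Nat.mul_le_mul_right _ hn
    have hpos : 1 ≤ M v := by
      have := sz_pos (n, ([] : List (List Bool)), w, u)
      omega
    have h2 : RunsP O gather (enc (n, ([] : List (List Bool)), w, u))
        ((iid ((O w).map (List.take u.size)) n).map fun zs => enc (0, zs, w, u))
        ((n + 1) * (22 * M v)) := fun k hk =>
      gather_yields w u k n (M v) [] (by omega) hk k (by nlinarith)
    have h3 : RunsP O (.comp gather c.strip) v _ _ := (h1.strip ht).comp_pure h2
    have h4 : (n + 1) * (22 * M v) ≤ (sz n + 1) * (22 * M v) :=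
      Nat.mul_le_mul_right _ (by omega)
    have h5 : RunsP O (.comp d.strip (.comp gather c.strip)) v _ _ := fun k hk =>
      ((h3 k (by omega)).andThen_map (T := q.eval (M v))
        (E := fun zs => PMF.pure (enc (post (zs, w, u))))
        fun zs hzs => by
          obtain ⟨s, hs, h6⟩ := hd (0, zs, w, u)
          have h7 : sz (0, zs, w, u) ≤ M v := by
            -- The list of truncated answers still fits the bound `M v`, although the answers of the
            -- oracle themselves may be arbitrarily long.
            have h8 := sz_list_le zs (B := 2 * u.size + 1) fun z hz => by
              have := mem_of_mem_iid hzs z hz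
              rw [PMF.support_map] at this
              obtain ⟨y, -, rfl⟩ := this
              rw [sz_bits]
              have := List.length_take_le u.size y
              omega
            rw [length_of_mem_iid hzs] at h8
            change sz zs ≤ n * (2 * u.size + 2) + 1 at h8
            rw [hMv]
            simp only [sz_pair, sz_nat, sz_nil] at *
            omega
          have h9 := hs.trans ((hq _).trans (eval_mono q h7))
          exact (h6.strip h9) k (le_trans (by omega) hk)).tick v.size
    rw [PMF.map, Function.comp_def]
    have h10 : v.size = sz v := rfl
    have h11 : (enc v).size = sz v := rfl
    have h12 : T.eval v.size = T.eval (sz v) := rfl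
    exact h5.mono (by omega)
  refine ⟨⟨_, T, coins, fun O v => (key O v _ le_rfl).2⟩, rfl, fun O v => ?_⟩
  rw [(key O v _ le_rfl).1, PMF.map_comp]
  rfl

end

/-! ## The programs of the reduction -/

/-- The output of `M` on `v` with coins `ρ`. -/
def PPT.runWith (M : PPT) (v : Data) (ρ : List Bool) : Data := M.run (.pair v (ofBits ρ))

theorem PPT.dist_eq (M : PPT) (v : Data) :
    M.dist v = (uniformBits (M.coins.eval v.size)).map (M.runWith v) := rfl

/-- A bound for the size of the output in terms of the size of the input. -/
noncomputable def PolyTime.outSize (M : PolyTime) : Polynomial ℕ :=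
  .C M.code.growth * M.time

theorem PolyTime.size_run_le (M : PolyTime) (v : Data) : (M.run v).size ≤ M.outSize.eval v.size := by
  obtain ⟨d, t, h, ht⟩ := M.halts v
  simp only [PolyTime.run, h, PolyTime.outSize, Polynomial.eval_mul, Polynomial.eval_C,
    Option.map_some, Option.getD_some]
  exact (exec₀_size h).2.trans (Nat.mul_le_mul_left _ ht)

theorem PPT.length_runWith_le (M : PPT) (v d : Data) (ρ : List Bool) {m : ℕ}
    (hv : v.size + (2 * ρ.length + 1) + 1 ≤ m) (hd : d.size ≤ (M.runWith v ρ).size) :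
    (toBits d).length ≤ M.outSize.eval m := by
  refine (length_toBits_le d).trans (hd.trans ((M.size_run_le _).trans (eval_mono _ ?_)))
  rwa [Data.size, size_ofBits]

theorem Data.size_fst_le (d : Data) : d.fst.size ≤ d.size := by
  cases d <;> simp [Data.fst, Data.size]; omega

theorem Data.size_snd_le (d : Data) : d.snd.size ≤ d.size := by
  cases d <;> simp [Data.snd, Data.size]; omega

/-- The common reference string for length `n` from the coins `ρ`. -/
def crsOf (Gen : PPT) (n : ℕ) (ρ : List Bool) : List Bool :=
  toBits (Gen.runWith (ofBits (List.replicate n true)) ρ)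

/-- The input of the verifier. -/
def verInput (x r π : List Bool) : Data := .pair (ofBits x) (.pair (ofBits r) (ofBits π))

theorem size_verInput (x r π : List Bool) : (verInput x r π).size =
    2 * x.length + 1 + (2 * r.length + 1 + (2 * π.length + 1) + 1) + 1 := by
  simp only [verInput, Data.size, size_ofBits]

/-- Whether the verifier accepts with coins `ρ`. -/
def accepts (V : PPT) (x r π ρ : List Bool) : Bool :=
  decide (V.runWith (verInput x r π) ρ = bit true)

theorem verdict_eq (V : PPT) (x r π : List Bool) : verdict V x r π =
    (uniformBits (V.coins.eval (verInput x r π).size)).map (accepts V x r π) := by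
  rw [verdict, PPT.decision, PPT.dist_eq, PMF.map_comp]
  rfl

/-- The number of coins of the simulator. -/
noncomputable def simCoins (Sim : PPT) : Polynomial ℕ := Sim.coins.comp (2 * .X + 1)

/-- The output of the simulator, the coins being a prefix of `z`. -/
noncomputable def simOut (Sim : PPT) (x z : List Bool) : Data :=
  Sim.runWith (ofBits x) (z.take ((simCoins Sim).eval x.length))

/-- The simulated common reference string. -/
noncomputable def simCrs (Sim : PPT) (x z : List Bool) : List Bool := toBits (simOut Sim x z).fst

/-- The simulated proof. -/
noncomputable def simProof (Sim : PPT) (x z : List Bool) : List Bool := toBits (simOut Sim x z).snd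

/-- The common reference strings and the simulated proofs are not longer than that. -/
noncomputable def lenBound (Gen Sim : PPT) : Polynomial ℕ :=
  Gen.outSize.comp (2 * .X + 1 + (2 * simCoins Gen + 1) + 1) +
    Sim.outSize.comp (2 * .X + 1 + (2 * simCoins Sim + 1) + 1)

theorem length_crsOf_le (Gen Sim : PPT) (n : ℕ) (ρ : List Bool)
    (hρ : ρ.length ≤ (simCoins Gen).eval n) :
    (crsOf Gen n ρ).length ≤ (lenBound Gen Sim).eval n := by
  refine (Gen.length_runWith_le _ _ ρ (m := 2 * n + 1 + (2 * (simCoins Gen).eval n + 1) + 1) ?_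
    le_rfl).trans ?_
  · rw [size_ofBits, List.length_replicate]
    omega
  · simp [lenBound]

theorem length_simCrs_le (Gen Sim : PPT) (x z : List Bool) :
    (simCrs Sim x z).length ≤ (lenBound Gen Sim).eval x.length := by
  refine (Sim.length_runWith_le _ _ _
    (m := 2 * x.length + 1 + (2 * (simCoins Sim).eval x.length + 1) + 1) ?_
    (Data.size_fst_le _)).trans ?_
  · rw [size_ofBits]
    have := List.length_take_le ((simCoins Sim).eval x.length) z
    omega
  · simp [lenBound]

theorem length_simProof_le (Gen Sim : PPT) (x z : List Bool) :
    (simProof Sim x z).length ≤ (lenBound Gen Sim).eval x.length := by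
  refine (Sim.length_runWith_le _ _ _
    (m := 2 * x.length + 1 + (2 * (simCoins Sim).eval x.length + 1) + 1) ?_
    (Data.size_snd_le _)).trans ?_
  · rw [size_ofBits]
    have := List.length_take_le ((simCoins Sim).eval x.length) z
    omega
  · simp [lenBound]

/-- Count the accepting ones among `m` runs of the verifier; each of them takes its coins from a
block of `B` bits. -/
noncomputable def runTrials (V : PPT) (x r π : List Bool) (B m : ℕ) (ρ : List Bool) :
    ℕ × List Bool :=
  (List.replicate m ()).foldl (fun s _ =>
    (if accepts V x r π (s.2.take (V.coins.eval (verInput x r π).size)) then s.1 + 1 else s.1,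
      s.2.drop B)) (0, ρ)

/-- The most successful one of the proofs simulated with the strings `zs`. -/
noncomputable def runBest (V Sim : PPT) (x r : List Bool) (B m : ℕ) (zs : List (List Bool))
    (ρ : List Bool) : (List Bool × ℕ) × List Bool :=
  zs.foldl (fun s z =>
    (if s.1.2 < (runTrials V x r (simProof Sim x z) B m s.2).1 then
      (simProof Sim x z, (runTrials V x r (simProof Sim x z) B m s.2).1) else s.1,
      (runTrials V x r (simProof Sim x z) B m s.2).2)) (([], 0), ρ)

/-- Run the inverter `k` times on `(x, y)`. -/
noncomputable def runInv (A : PPT) (x y : List Bool) (k : ℕ) (ρ : List Bool) :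
    List (List Bool) × List Bool :=
  (List.replicate k ()).foldl (fun s _ =>
    (toBits (A.runWith (.pair (ofBits x) (ofBits y))
      (s.2.take (A.coins.eval (Data.pair (ofBits x) (ofBits y)).size))) :: s.1,
      s.2.drop (A.coins.eval (Data.pair (ofBits x) (ofBits y)).size))) ([], ρ)

/-- An injective encoding of the strings of length at most `N` by strings of length `N + 1`. -/
def pad (N : ℕ) (r : List Bool) : List Bool := (r ++ true :: List.replicate N false).take (N + 1)

theorem length_pad (N : ℕ) (r : List Bool) : (pad N r).length = N + 1 := by
  simp [pad]

/-- Since the length is at most `N`, the marker `true` survives the truncation; the original string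
is what precedes the last `true`. -/
theorem pad_inj {N : ℕ} {r r' : List Bool} (hr : r.length ≤ N) (hr' : r'.length ≤ N)
    (h : pad N r = pad N r') : r = r' := by
  induction r generalizing r' N with
  | nil =>
    cases r' with
    | nil => rfl
    | cons b l =>
      exfalso
      obtain ⟨N, rfl⟩ : ∃ M, N = M + 1 := ⟨N - 1, by simp at hr'; omega⟩
      simp only [pad, List.nil_append, List.cons_append, List.take_succ_cons, List.cons.injEq] at h
      have h1 : true ∈ (l ++ true :: List.replicate (N + 1) false).take (N + 1) := by
        rw [List.take_append, List.mem_append]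
        right
        obtain ⟨k, hk⟩ : ∃ k, N + 1 - l.length = k + 1 :=
          ⟨N - l.length, by simp at hr'; omega⟩
        simp [hk]
      rw [← h.2] at h1
      simp at h1
  | cons b l ih =>
    obtain ⟨N, rfl⟩ : ∃ M, N = M + 1 := ⟨N - 1, by simp at hr; omega⟩
    -- The last `false` lies beyond the cut, so the padding can be shortened to fit the induction
    -- hypothesis for `N`.
    have drop_last : ∀ s : List Bool, (s ++ true :: List.replicate (N + 1) false).take (N + 1) =
        (s ++ true :: List.replicate N false).take (N + 1) := by
      intro s
      rw [List.replicate_succ', ← List.cons_append, ← List.append_assoc,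
        List.take_append_of_le_length (by simp)]
    cases r' with
    | nil =>
      exfalso
      simp only [pad, List.nil_append, List.cons_append, List.take_succ_cons, List.cons.injEq] at h
      have h1 : true ∈ (l ++ true :: List.replicate (N + 1) false).take (N + 1) := by
        rw [List.take_append, List.mem_append]
        right
        obtain ⟨k, hk⟩ : ∃ k, N + 1 - l.length = k + 1 :=
          ⟨N - l.length, by simp at hr; omega⟩
        simp [hk]
      rw [h.2] at h1
      simp at h1
    | cons b' l' =>
      simp only [pad, List.cons_append, List.take_succ_cons, List.cons.injEq, drop_last] at h
      rw [h.1, ih (N := N) (by simpa using hr) (by simpa using hr') h.2]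

/-! ### Polynomial time of the components of the reduction -/

section Poly

variable {α : Type} [Enc α]

theorem Poly.runWith (M : PPT) {v : α → Data} {ρ : α → List Bool} (hv : Poly v) (hρ : Poly ρ) :
    Poly (fun a => M.runWith (v a) (ρ a)) :=
  .run _ (hv.dataPair hρ.dataOfBits)

theorem Poly.crsOf (Gen : PPT) {n : α → ℕ} {ρ : α → List Bool} (hn : Poly n) (hρ : Poly ρ) :
    Poly (fun a => crsOf Gen (n a) (ρ a)) :=
  ((hn.replicate (.const true)).dataOfBits.runWith Gen hρ).dataToBits

theorem Poly.verInput {x r π : α → List Bool} (hx : Poly x) (hr : Poly r) (hπ : Poly π) :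
    Poly (fun a => verInput (x a) (r a) (π a)) :=
  hx.dataOfBits.dataPair (hr.dataOfBits.dataPair hπ.dataOfBits)

theorem Poly.natSucc {n : α → ℕ} (hn : Poly n) : Poly (fun a => n a + 1) := hn.natAdd (.const 1)

theorem Poly.size_ofBits {x : α → List Bool} (hx : Poly x) : Poly (fun a => (ofBits (x a)).size) :=
  ((Poly.const 2).natMul hx.length).natSucc.cast fun a => by rw [Data.size_ofBits]

theorem Poly.size_pair {d e : α → Data} (hd : Poly fun a => (d a).size)
    (he : Poly fun a => (e a).size) : Poly (fun a => (Data.pair (d a) (e a)).size) :=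
  (hd.natAdd he).natSucc

theorem Poly.size_verInput {x r π : α → List Bool} (hx : Poly x) (hr : Poly r) (hπ : Poly π) :
    Poly (fun a => (NIZK.verInput (x a) (r a) (π a)).size) :=
  hx.size_ofBits.size_pair (hr.size_ofBits.size_pair hπ.size_ofBits)

theorem Poly.accepts (V : PPT) {x r π ρ : α → List Bool} (hx : Poly x) (hr : Poly r) (hπ : Poly π)
    (hρ : Poly ρ) : Poly (fun a => accepts V (x a) (r a) (π a) (ρ a)) :=
  ((hx.verInput hr hπ).runWith V hρ).dataEq (.const _)

theorem Poly.simOut (Sim : PPT) {x z : α → List Bool} (hx : Poly x) (hz : Poly z) :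
    Poly (fun a => simOut Sim (x a) (z a)) :=
  hx.dataOfBits.runWith Sim (Poly.take (hx.length.natEval _) hz)

theorem Poly.simProof (Sim : PPT) {x z : α → List Bool} (hx : Poly x) (hz : Poly z) :
    Poly (fun a => simProof Sim (x a) (z a)) := (hx.simOut Sim hz).dataSnd.dataToBits

theorem Poly.simCrs (Sim : PPT) {x z : α → List Bool} (hx : Poly x) (hz : Poly z) :
    Poly (fun a => simCrs Sim (x a) (z a)) := (hx.simOut Sim hz).dataFst.dataToBits

theorem Poly.pad {N : α → ℕ} {r : α → List Bool} (hN : Poly N) (hr : Poly r) :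
    Poly (fun a => pad (N a) (r a)) :=
  hN.natSucc.take (hr.append ((Poly.const true).cons (hN.replicate (.const false))))

theorem runTrials_le (V : PPT) (x r π : List Bool) (B m : ℕ) (ρ : List Bool) :
    (runTrials V x r π B m ρ).1 ≤ m ∧ (runTrials V x r π B m ρ).2.length ≤ ρ.length := by
  suffices ∀ c, ((List.replicate m ()).foldl (fun (s : ℕ × List Bool) _ =>
      (if NIZK.accepts V x r π (s.2.take (V.coins.eval (NIZK.verInput x r π).size)) then s.1 + 1
        else s.1, s.2.drop B)) (c, ρ)).1 ≤ c + m ∧ ((List.replicate m ()).foldl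
      (fun (s : ℕ × List Bool) _ => (if NIZK.accepts V x r π
        (s.2.take (V.coins.eval (NIZK.verInput x r π).size)) then s.1 + 1
        else s.1, s.2.drop B)) (c, ρ)).2.length ≤ ρ.length by simpa [runTrials] using this 0
  induction m generalizing ρ with
  | zero => simp
  | succ m ih =>
    intro c
    rw [List.replicate_succ, List.foldl_cons]
    have h := ih (ρ.drop B) (if NIZK.accepts V x r π
        (ρ.take (V.coins.eval (NIZK.verInput x r π).size)) then c + 1 else c)
    refine ⟨h.1.trans ?_, h.2.trans (by simp)⟩
    split_ifs <;> omega

theorem Poly.runTrials (V : PPT) {x r π ρ : α → List Bool} {B m : α → ℕ} (hx : Poly x) (hr : Poly r)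
    (hπ : Poly π) (hB : Poly B) (hm : Poly m) (hρ : Poly ρ) :
    Poly (fun a => runTrials V (x a) (r a) (π a) (B a) (m a) (ρ a)) := by
  refine Poly.foldl_of_add (s := fun q : α × (ℕ × List Bool) × Unit =>
    (if NIZK.accepts V (x q.1) (r q.1) (π q.1) (q.2.1.2.take
      (V.coins.eval (NIZK.verInput (x q.1) (r q.1) (π q.1)).size)) then q.2.1.1 + 1 else q.2.1.1,
        q.2.1.2.drop (B q.1))) hm.units ((Poly.const 0).pair hρ) ?_ (.const 2) ?_
  · have hx' := hx.comp (Poly.id (α := α × (ℕ × List Bool) × Unit)).fst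
    have hr' := hr.comp (Poly.id (α := α × (ℕ × List Bool) × Unit)).fst
    have hπ' := hπ.comp (Poly.id (α := α × (ℕ × List Bool) × Unit)).fst
    exact (Poly.ite (hx'.accepts V hr' hπ' (((hx'.size_verInput hr' hπ').natEval _).take
      Poly.id.snd.fst.snd)) Poly.id.snd.fst.fst.natSucc Poly.id.snd.fst.fst).pair
      ((hB.comp Poly.id.fst).drop Poly.id.snd.fst.snd)
  · rintro a ⟨c, l⟩ _ _
    simp only [sz_pair, sz_nat, sz_bits, List.length_drop]
    split_ifs <;> omega

theorem Poly.runBest (V Sim : PPT) {x r ρ : α → List Bool} {B m : α → ℕ}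
    {zs : α → List (List Bool)} (hx : Poly x) (hr : Poly r) (hB : Poly B) (hm : Poly m)
    (hzs : Poly zs) (hρ : Poly ρ) :
    Poly (fun a => runBest V Sim (x a) (r a) (B a) (m a) (zs a) (ρ a)) := by
  have h1 : Poly fun p : List Bool × List Bool => NIZK.simProof Sim p.1 p.2 :=
    Poly.id.fst.simProof Sim Poly.id.snd
  obtain ⟨q, hq⟩ := h1.bd
  refine Poly.foldl_of_add (s := fun q : α × ((List Bool × ℕ) × List Bool) × List Bool =>
    (if q.2.1.1.2 < (NIZK.runTrials V (x q.1) (r q.1) (NIZK.simProof Sim (x q.1) q.2.2) (B q.1)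
      (m q.1) q.2.1.2).1 then (NIZK.simProof Sim (x q.1) q.2.2, (NIZK.runTrials V (x q.1) (r q.1)
        (NIZK.simProof Sim (x q.1) q.2.2) (B q.1) (m q.1) q.2.1.2).1) else q.2.1.1,
      (NIZK.runTrials V (x q.1) (r q.1) (NIZK.simProof Sim (x q.1) q.2.2) (B q.1) (m q.1)
        q.2.1.2).2)) hzs ((Poly.const ([], 0)).pair hρ) ?_
      ((((hx.bd.add hzs.bd).add (.const 1)).eval q).add hm.bd) ?_
  · have i := (Poly.id (α := α × ((List Bool × ℕ) × List Bool) × List Bool))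
    have h2 := (hx.comp i.fst).simProof Sim i.snd.snd
    have h3 := (hx.comp i.fst).runTrials V (hr.comp i.fst) h2 (hB.comp i.fst) (hm.comp i.fst)
      i.snd.fst.snd
    exact ((Poly.ite (i.snd.fst.fst.snd.natLt h3.fst) (h2.pair h3.fst) i.snd.fst.fst).pair
      h3.snd).cast fun a => by simp only [decide_eq_true_eq]
  · rintro a ⟨⟨p, c⟩, l⟩ z hz
    have h2 : sz (NIZK.simProof Sim (x a) z) ≤ _ := (hq (x a, z)).trans
      (eval_mono q (n := sz (x a) + sz (zs a) + 1) (by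
        have := sz_mem hz
        rw [sz_pair]
        omega))
    have h3 := runTrials_le V (x a) (r a) (NIZK.simProof Sim (x a) z) (B a) (m a) l
    simp only [sz_pair, sz_bits, sz_nat] at h2 ⊢
    split_ifs
    · simp only [sz_pair, sz_bits, sz_nat]
      omega
    · simp only [sz_pair, sz_bits, sz_nat]
      omega

theorem Poly.runInv (A : PPT) {x y ρ : α → List Bool} {k : α → ℕ} (hx : Poly x) (hy : Poly y)
    (hk : Poly k) (hρ : Poly ρ) : Poly (fun a => runInv A (x a) (y a) (k a) (ρ a)) := by
  have h0 : Poly fun a => A.coins.eval (Data.pair (ofBits (x a)) (ofBits (y a))).size :=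
    (hx.size_ofBits.size_pair hy.size_ofBits).natEval _
  have h1 : Poly fun p : α × List Bool =>
      toBits (A.runWith (.pair (ofBits (x p.1)) (ofBits (y p.1))) p.2) :=
    (((hx.comp Poly.id.fst).dataOfBits.dataPair (hy.comp Poly.id.fst).dataOfBits).runWith A
      Poly.id.snd).dataToBits
  obtain ⟨q, hq⟩ := h1.bd
  refine Poly.foldl_of_add (s := fun q : α × (List (List Bool) × List Bool) × Unit =>
    (toBits (A.runWith (.pair (ofBits (x q.1)) (ofBits (y q.1)))
      (q.2.1.2.take (A.coins.eval (Data.pair (ofBits (x q.1)) (ofBits (y q.1))).size))) :: q.2.1.1,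
      q.2.1.2.drop (A.coins.eval (Data.pair (ofBits (x q.1)) (ofBits (y q.1))).size)))
    hk.units ((Poly.const []).pair hρ) ?_
    ((((PolyBd.size.add h0.bd).add (.const 1)).eval q).add (.const 1)) ?_
  · have i := (Poly.id (α := α × (List (List Bool) × List Bool) × Unit))
    have h2 := h0.comp i.fst
    exact ((h1.comp (i.fst.pair (h2.take i.snd.fst.snd))).cons i.snd.fst.fst).pair
      (h2.drop i.snd.fst.snd)
  · rintro a ⟨c, l⟩ _ _
    have h2 : sz (toBits (A.runWith (.pair (ofBits (x a)) (ofBits (y a))) (l.take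
        (A.coins.eval (Data.pair (ofBits (x a)) (ofBits (y a))).size)))) ≤ _ :=
      (hq (a, l.take (A.coins.eval (Data.pair (ofBits (x a)) (ofBits (y a))).size))).trans
        (eval_mono q (n := sz a +
          sz (A.coins.eval (Data.pair (ofBits (x a)) (ofBits (y a))).size) + 1) (by
        rw [sz_pair, sz_bits, sz_nat]
        have := List.length_take_le (A.coins.eval (Data.pair (ofBits (x a)) (ofBits (y a))).size)
          l
        omega))
    simp only [sz_pair, sz_cons, sz_bits l, sz_bits (l.drop _), List.length_drop]
    omega

end Poly

/-! ### Output distributions of the components -/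

section Specs

theorem samples_runTrials (V : PPT) (x r π : List Bool) {B : ℕ} (m : ℕ)
    (h : V.coins.eval (verInput x r π).size ≤ B) :
    Samples (runTrials V x r π B m) (successes (verdict V x r π) m) (m * B) := by
  have := Samples.foldl (h := fun (s : ℕ × List Bool) (_ : Unit) =>
    (if accepts V x r π (s.2.take (V.coins.eval (verInput x r π).size)) then s.1 + 1 else s.1,
      s.2.drop B)) (step := fun c _ => (verdict V x r π).map fun b => if b then c + 1 else c)
    (N := B) (List.replicate m ()) (fun s _ _ => by
      rw [verdict_eq]
      exact (Samples.of_take h (accepts V x r π)).map fun b => if b then s + 1 else s) 0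
  rw [List.length_replicate] at this
  exact this

theorem samples_runBest (V Sim : PPT) (x r : List Bool) {B : ℕ} (m : ℕ) (zs : List (List Bool))
    (h : ∀ z, V.coins.eval (verInput x r (simProof Sim x z)).size ≤ B) :
    Samples (runBest V Sim x r B m zs) (best (verdict V x r) (simProof Sim x) m zs)
      (zs.length * (m * B)) :=
  Samples.foldl (h := fun (s : (List Bool × ℕ) × List Bool) (z : List Bool) =>
    (if s.1.2 < (runTrials V x r (simProof Sim x z) B m s.2).1 then
      (simProof Sim x z, (runTrials V x r (simProof Sim x z) B m s.2).1) else s.1,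
      (runTrials V x r (simProof Sim x z) B m s.2).2)) zs (fun s z _ =>
        (samples_runTrials V x r (simProof Sim x z) m (h z)).map
          fun c => if s.2 < c then (simProof Sim x z, c) else s) ([], 0)

theorem samples_runInv (A : PPT) (x y : List Bool) (k : ℕ) :
    Samples (runInv A x y k) (iid (A.distBits (.pair (ofBits x) (ofBits y))) k)
      (k * A.coins.eval (Data.pair (ofBits x) (ofBits y)).size) := by
  have := Samples.foldl (h := fun (s : List (List Bool) × List Bool) (_ : Unit) =>
    (toBits (A.runWith (.pair (ofBits x) (ofBits y))
      (s.2.take (A.coins.eval (Data.pair (ofBits x) (ofBits y)).size))) :: s.1,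
      s.2.drop (A.coins.eval (Data.pair (ofBits x) (ofBits y)).size)))
    (step := fun acc _ => (A.distBits (.pair (ofBits x) (ofBits y))).map fun z => z :: acc)
    (List.replicate k ()) (fun s _ _ => by
      rw [PPT.distBits, PPT.dist_eq, PMF.map_comp (p := uniformBits _)]
      exact (Samples.of_take le_rfl (toBits ∘ A.runWith _)).map fun z => z :: s) []
  rw [List.length_replicate] at this
  exact this

end Specs

theorem Poly.exists_ppt {β : Type} [Enc β] {f : Data → β} (hf : Poly f) (coins : Polynomial ℕ) :
    ∃ M : PPT, ∀ v, M.dist v =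
      (uniformBits (coins.eval v.size)).map fun ρ => enc (f (.pair v (ofBits ρ))) := by
  obtain ⟨M, hM⟩ := hf.exists_polyTime
  exact ⟨⟨M, coins⟩, fun v => congrArg (fun g => PMF.map g _) (funext fun ρ => hM _)⟩

/-! ### The inverted function, the cheating prover and the comparison test -/

section Reduction

variable (Gen V Sim : PPT) (kP : Polynomial ℕ)

/-- The number of coins that the reduction reserves for a run of the verifier. -/
noncomputable def blockLen : Polynomial ℕ :=
  V.coins.comp (2 * .X + 1 + (2 * lenBound Gen Sim + 1 + (2 * lenBound Gen Sim + 1) + 1) + 1)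

theorem coins_le_blockLen {x r π : List Bool} (hr : r.length ≤ (lenBound Gen Sim).eval x.length)
    (hπ : π.length ≤ (lenBound Gen Sim).eval x.length) :
    V.coins.eval (verInput x r π).size ≤ (blockLen Gen V Sim).eval x.length := by
  rw [size_verInput]
  simp only [blockLen, Polynomial.eval_comp]
  refine eval_mono _ ?_
  simp only [Polynomial.eval_add, Polynomial.eval_mul, Polynomial.eval_one, Polynomial.eval_ofNat,
    Polynomial.eval_X]
  omega

/-- The number of trials for every candidate. -/
noncomputable def trials : Polynomial ℕ := ((kP + 1) ^ 2) ^ 2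

theorem eval_trials (n : ℕ) : (trials kP).eval n = ((kP.eval n + 1) ^ 2) ^ 2 := by
  simp [trials]

/-- The value of the function `f_x`: the simulated common reference string, padded. -/
noncomputable def padCrs (x r : List Bool) : List Bool := pad ((lenBound Gen Sim).eval x.length) r

/-- The function family that is inverted. -/
theorem exists_funFamily : ∃ F : FunFamily, F.inLen = simCoins Sim ∧
    F.f = fun x z => padCrs Gen Sim x (simCrs Sim x z) := by
  have i := Poly.id (α := Data)
  have hx := i.dataFst.dataToBits
  obtain ⟨M, hM⟩ := ((hx.length.natEval (lenBound Gen Sim)).pad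
    (hx.simCrs Sim i.dataSnd.dataToBits)).exists_polyTime
  refine ⟨⟨simCoins Sim, lenBound Gen Sim + 1, _, M, fun x z _ => ?_, fun x z _ => ?_⟩, rfl, rfl⟩
  · rw [hM, enc_bits]
    simp only [Data.fst, Data.snd, toBits_ofBits]
    rfl
  · simp

variable (A : PPT)

/-- The distribution of the answers of `A` to the query for `r`. -/
noncomputable def answers (x r : List Bool) : PMF (List Bool) :=
  A.distBits (.pair (ofBits x) (ofBits (padCrs Gen Sim x r)))

/-- The number of coins for a run of `A`. -/
noncomputable def invCoins : Polynomial ℕ :=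
  A.coins.comp (2 * .X + 1 + (2 * (lenBound Gen Sim + 1) + 1) + 1)

theorem eval_invCoins (x r : List Bool) : (invCoins Gen Sim A).eval x.length =
    A.coins.eval (Data.pair (ofBits x) (ofBits (padCrs Gen Sim x r))).size := by
  simp [invCoins, Data.size, size_ofBits, padCrs, length_pad]

/-- The distribution of the proof that the reduction finds, with its number of successes. -/
noncomputable def found (x r : List Bool) : PMF (List Bool × ℕ) :=
  selection (verdict V x r) (simProof Sim x) ((trials kP).eval x.length) (answers Gen Sim A x r)
    (kP.eval x.length)

/-- Sample from `found` by running `A`. -/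
noncomputable def findProof (x r ρ : List Bool) : (List Bool × ℕ) × List Bool :=
  runBest V Sim x r ((blockLen Gen V Sim).eval x.length) ((trials kP).eval x.length)
    (runInv A x (padCrs Gen Sim x r) (kP.eval x.length) ρ).1
    (runInv A x (padCrs Gen Sim x r) (kP.eval x.length) ρ).2

/-- The number of coins of `findProof`. -/
noncomputable def findCoins : Polynomial ℕ :=
  kP * invCoins Gen Sim A + kP * (trials kP * blockLen Gen V Sim)

/-- Reference strings and simulated proofs have bounded length, so one block length serves all
verifier runs and the total number of coins is a polynomial in the length of `x`. -/
theorem samples_findProof {x r : List Bool} (hr : r.length ≤ (lenBound Gen Sim).eval x.length) :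
    Samples (findProof Gen V Sim kP A x r) (found Gen V Sim kP A x r)
      ((findCoins Gen V Sim kP A).eval x.length) := by
  have := (samples_runInv A x (padCrs Gen Sim x r) (kP.eval x.length)).bind
    (N' := kP.eval x.length * ((trials kP).eval x.length * (blockLen Gen V Sim).eval x.length))
    (g := runBest V Sim x r ((blockLen Gen V Sim).eval x.length) ((trials kP).eval x.length))
    (fun zs hzs => by
      have := samples_runBest V Sim x r ((trials kP).eval x.length) zs fun z =>
        coins_le_blockLen Gen V Sim hr (length_simProof_le Gen Sim x z)
      rwa [length_of_mem_iid hzs] at this)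
  rw [← eval_invCoins] at this
  simp only [findCoins, Polynomial.eval_add, Polynomial.eval_mul]
  exact this

theorem Poly.padCrs {α : Type} [Enc α] {x r : α → List Bool} (hx : Poly x) (hr : Poly r) :
    Poly fun a => padCrs Gen Sim (x a) (r a) :=
  (hx.length.natEval _).pad hr

theorem Poly.findProof {α : Type} [Enc α] {x r ρ : α → List Bool} (hx : Poly x) (hr : Poly r)
    (hρ : Poly ρ) : Poly fun a => findProof Gen V Sim kP A (x a) (r a) (ρ a) := by
  have h := hx.runInv A (Poly.padCrs Gen Sim hx hr) (hx.length.natEval kP) hρ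
  exact hx.runBest V Sim hr (hx.length.natEval _) (hx.length.natEval _) h.fst h.snd

/-- The malicious prover that finds a proof with the help of `A`. -/
theorem exists_cheat : ∃ S : PPT, ∀ x r, r.length ≤ (lenBound Gen Sim).eval x.length →
    S.cheat x r = (found Gen V Sim kP A x r).map Prod.fst := by
  have i := Poly.id (α := Data)
  obtain ⟨S, hS⟩ := (Poly.findProof Gen V Sim kP A i.dataFst.dataFst.dataToBits
    i.dataFst.dataSnd.dataToBits i.dataSnd.dataToBits).fst.fst.exists_ppt
      (findCoins Gen V Sim kP A)
  refine ⟨S, fun x r hr => ?_⟩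
  rw [PPT.cheat, PPT.distBits, hS, PMF.map_comp]
  simp only [Data.fst, Data.snd, toBits_ofBits, Function.comp_def, enc_bits]
  rw [← (samples_findProof Gen V Sim kP A hr).dist (eval_mono _ (n := (Data.pair (ofBits x)
    (ofBits r)).size) (by rw [Data.size, size_ofBits]; omega)), PMF.map_comp]
  rfl

/-- The distinguisher that compares a proof with the one that is found with the help of `A`. -/
theorem exists_comparison : ∃ M : PPT, ∀ x r π, r.length ≤ (lenBound Gen Sim).eval x.length →
    M.decision (.pair (ofBits x) (.pair (ofBits r) (ofBits π))) true =
      beats (verdict V x r) (simProof Sim x) ((trials kP).eval x.length) (answers Gen Sim A x r)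
        (kP.eval x.length) π := by
  have i := Poly.id (α := Data)
  have hx := i.dataFst.dataFst.dataToBits
  have hr := i.dataFst.dataSnd.dataFst.dataToBits
  have hπ := i.dataFst.dataSnd.dataSnd.dataToBits
  have h := Poly.findProof Gen V Sim kP A hx hr i.dataSnd.dataToBits
  -- The rival proof `π` may come from an unbounded prover and be longer than `lenBound`. Its runs
  -- therefore use blocks of exactly the size the verifier needs on this input, which is polynomial
  -- in the size of the test's own input.
  have h2 := hx.runTrials V hr hπ ((hx.size_verInput hr hπ).natEval V.coins)
    (hx.length.natEval (trials kP)) h.snd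
  obtain ⟨M, hM⟩ := (h.fst.snd.natLt h2.fst).exists_ppt
    (findCoins Gen V Sim kP A + trials kP * V.coins)
  refine ⟨M, fun x r π hrl => ?_⟩
  have hs := ((samples_findProof Gen V Sim kP A hrl).bind fun b _ =>
    (samples_runTrials V x r π ((trials kP).eval x.length) le_rfl).map
      fun c => decide (b.2 < c)).dist
    (C := (findCoins Gen V Sim kP A + trials kP * V.coins).eval (verInput x r π).size) (by
      have hle : x.length ≤ (verInput x r π).size := by
        rw [size_verInput]
        omega
      rw [Polynomial.eval_add, Polynomial.eval_mul]
      exact add_le_add (eval_mono _ hle) (Nat.mul_le_mul_right _ (eval_mono _ hle)))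
  have hd : M.decision (verInput x r π) = (found Gen V Sim kP A x r).bind fun b =>
      (successes (verdict V x r π) ((trials kP).eval x.length)).map fun c => decide (b.2 < c) := by
    rw [← hs, PPT.decision, hM, PMF.map_comp]
    refine congrArg (fun g => PMF.map g _) (funext fun ρ => ?_)
    simp only [verInput, Data.fst, Data.snd, toBits_ofBits, Function.comp_def, Enc.enc, bit.injEq,
      Bool.decide_eq_true]
    rfl
  change M.decision (verInput x r π) true = _
  rw [hd, ← ex_ind_eq, ex_bind, beats]
  refine ex_congr _ fun b _ => ?_
  rw [ex_map]
  simp only [decide_eq_true_eq]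

theorem iid_map {α β : Type} (μ : PMF α) (g : α → β) (k : ℕ) :
    iid (μ.map g) k = (iid μ k).map (List.map g) := by
  have key : ∀ acc : List α, foldP (fun acc (_ : Unit) => (μ.map g).map fun z => z :: acc)
      (List.replicate k ()) (acc.map g) = (foldP (fun acc (_ : Unit) => μ.map fun z => z :: acc)
      (List.replicate k ()) acc).map (List.map g) := by
    induction k with
    | zero => simp [foldP, PMF.pure_map]
    | succ k ih =>
      intro acc
      rw [List.replicate_succ, foldP, foldP, PMF.map_bind, PMF.map_comp, PMF.bind_map, PMF.bind_map]
      refine congrArg (PMF.bind μ) (funext fun z => ?_)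
      exact ih (z :: acc)
  exact key []

theorem runBest_map (x r : List Bool) (B m : ℕ) (g : List Bool → List Bool)
    (hg : ∀ z, simProof Sim x (g z) = simProof Sim x z) (zs : List (List Bool)) (ρ : List Bool) :
    runBest V Sim x r B m (zs.map g) ρ = runBest V Sim x r B m zs ρ := by
  simp only [runBest, List.foldl_map, hg]

/-- The simulator reads a fixed prefix of its coin string, so truncating oracle answers beyond that
prefix does not affect the reduction. -/
theorem simProof_take (x z : List Bool) {j : ℕ} (hj : (simCoins Sim).eval x.length ≤ j) :
    simProof Sim x (z.take j) = simProof Sim x z := by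
  rw [simProof, simProof, simOut, simOut, List.take_take, min_eq_left hj]

/-- The probability that the verifier accepts the proof found with the help of `A`. -/
noncomputable def successProb (x : List Bool) : ℝ≥0∞ :=
  ex (crs Gen x.length) fun r => ex (found Gen V Sim kP A x r) fun b => verdict V x r b.1 true

theorem crs_eq (n : ℕ) :
    crs Gen n = (uniformBits ((simCoins Gen).eval n)).map (crsOf Gen n) := by
  rw [crs, PPT.distBits, PPT.dist_eq, PMF.map_comp, size_ofBits, List.length_replicate]
  simp only [simCoins, Polynomial.eval_comp, Polynomial.eval_add, Polynomial.eval_mul,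
    Polynomial.eval_one, Polynomial.eval_ofNat, Polynomial.eval_X]
  rfl

theorem length_of_mem_crs {n : ℕ} {r : List Bool} (h : r ∈ (crs Gen n).support) :
    r.length ≤ (lenBound Gen Sim).eval n := by
  rw [crs_eq, PMF.support_map] at h
  obtain ⟨ρ, hρ, rfl⟩ := h
  exact length_crsOf_le Gen Sim n ρ (length_of_mem_uniformBits hρ).le

theorem acceptProb_eq (x : List Bool) (S : List Bool → PMF (List Bool)) : acceptProb Gen V x S =
    (ex (crs Gen x.length) fun r => ex (S r) fun π => verdict V x r π true).toReal := by
  rw [acceptProb, ← ex_ind_eq, ex_bind, transcript, ex_bind]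
  simp only [ex_map, ex_ind_eq]

end Reduction

/-! ### The oracle program of the reduction -/

section Reduction

variable (Gen V Sim : PPT) (kP : Polynomial ℕ)

/-- What the reduction computes before its queries: their number, the query and the data for the
rest of the computation. -/
noncomputable def prepare (v : Data) : ℕ × Data × Data :=
  let x := toBits v.fst
  let ρ := toBits v.snd
  let r := crsOf Gen x.length (ρ.take ((simCoins Gen).eval x.length))
  (kP.eval x.length, .pair (ofBits x) (ofBits (padCrs Gen Sim x r)),
    enc ((simCoins Sim).eval x.length, x, r, ρ.drop ((simCoins Gen).eval x.length)))

/-- Find a proof with the answers `zs` and run the verifier on it. -/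
noncomputable def check (x r : List Bool) (zs : List (List Bool)) (ρ : List Bool) : Bool :=
  let s := runBest V Sim x r ((blockLen Gen V Sim).eval x.length) ((trials kP).eval x.length) zs ρ
  accepts V x r s.1.1 (s.2.take (V.coins.eval (verInput x r s.1.1).size))

/-- What the reduction computes after its queries. -/
noncomputable def finish (s : List (List Bool) × Data × Data) : Bool :=
  check Gen V Sim kP (toBits s.2.2.snd.fst) (toBits s.2.2.snd.snd.fst) s.1
    (toBits s.2.2.snd.snd.snd)

theorem poly_prepare : Poly (prepare Gen Sim kP) := by
  have i := Poly.id (α := Data)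
  have hx := i.dataFst.dataToBits
  have hρ := i.dataSnd.dataToBits
  have hr := hx.length.crsOf Gen ((hx.length.natEval (simCoins Gen)).take hρ)
  have hy := Poly.padCrs Gen Sim hx hr
  have hu := (hx.length.natEval (simCoins Sim)).pair (hx.pair (hr.pair
    ((hx.length.natEval (simCoins Gen)).drop hρ)))
  exact (hx.length.natEval kP).pair ((hx.dataOfBits.dataPair hy.dataOfBits).pair
    (Poly.encode.comp hu))

theorem poly_finish : Poly (finish Gen V Sim kP) := by
  have i := Poly.id (α := List (List Bool) × Data × Data)
  have hx := i.snd.snd.dataSnd.dataFst.dataToBits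
  have hr := i.snd.snd.dataSnd.dataSnd.dataFst.dataToBits
  have hρ := i.snd.snd.dataSnd.dataSnd.dataSnd.dataToBits
  have h := hx.runBest V Sim hr (hx.length.natEval (blockLen Gen V Sim))
    (hx.length.natEval (trials kP)) i.fst hρ
  exact hx.accepts V hr h.fst.fst
    (((hx.size_verInput hr h.fst.fst).natEval V.coins).take h.snd)

/-- The winner is a simulated proof or the initial empty string, so a block of `blockLen` bits also
suffices for the final verification. -/
theorem length_of_mem_best {vd : List Bool → PMF Bool} {x : List Bool} {m : ℕ}
    {zs : List (List Bool)} {b : List Bool × ℕ}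
    (h : b ∈ (best vd (simProof Sim x) m zs).support) :
    b.1.length ≤ (lenBound Gen Sim).eval x.length := by
  have key : ∀ s : List Bool × ℕ, s.1.length ≤ (lenBound Gen Sim).eval x.length →
      b ∈ (foldP (challenge vd (simProof Sim x) m) zs s).support →
      b.1.length ≤ (lenBound Gen Sim).eval x.length := by
    clear h
    induction zs with
    | nil =>
      intro s hs h
      rw [foldP, PMF.support_pure, Set.mem_singleton_iff] at h
      rwa [h]
    | cons z zs ih =>
      intro s hs h
      rw [foldP, PMF.mem_support_bind_iff] at h
      obtain ⟨s', h1, h2⟩ := h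
      refine ih s' ?_ h2
      rw [challenge, PMF.support_map] at h1
      obtain ⟨c, -, rfl⟩ := h1
      dsimp only
      split_ifs
      · exact length_simProof_le Gen Sim x z
      · exact hs
  exact key _ (by simp) h

/-- The number of coins of the reduction. -/
noncomputable def reductionCoins : Polynomial ℕ :=
  simCoins Gen + (kP * (trials kP * blockLen Gen V Sim) + blockLen Gen V Sim)

theorem check_dist {x r : List Bool} {zs : List (List Bool)} {M : ℕ}
    (hr : r.length ≤ (lenBound Gen Sim).eval x.length) (hzs : zs.length = kP.eval x.length)
    (hM : (kP * (trials kP * blockLen Gen V Sim) + blockLen Gen V Sim).eval x.length ≤ M) :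
    (uniformBits M).map (check Gen V Sim kP x r zs) =
      (best (verdict V x r) (simProof Sim x) ((trials kP).eval x.length) zs).bind
        fun b => verdict V x r b.1 := by
  have h1 := samples_runBest V Sim x r ((trials kP).eval x.length) zs fun z =>
    coins_le_blockLen Gen V Sim hr (length_simProof_le Gen Sim x z)
  have h2 := (h1.bind fun b hb => Samples.of_take
    (coins_le_blockLen Gen V Sim hr (length_of_mem_best Gen Sim hb)) (accepts V x r b.1)).dist
    (C := M) (by
      rw [hzs]
      simpa using hM)
  simp only [← verdict_eq] at h2
  exact h2

/-- One program `R` serves all inverters `A`, and its acceptance probability is exactly that of the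
idealized experiment; both halves of the theorem rest on this identity. -/
theorem exists_reduction : ∃ R : OraclePPT, ∀ (A : PPT) (x : List Bool),
    R.acceptProb A.distBits (ofBits x) = (successProb Gen V Sim kP A x).toReal := by
  obtain ⟨R, hR, h⟩ := exists_oraclePPT (poly_prepare Gen Sim kP) (poly_finish Gen V Sim kP)
    (reductionCoins Gen V Sim kP)
  refine ⟨R, fun A x => ?_⟩
  set n := x.length with hn
  -- The coin string splits into the coins of `Gen` and `M` further ones. The size of the encoding
  -- of `x` is at least `n`, so these suffice for the selection and the last verification.
  obtain ⟨M, hM⟩ : ∃ M, (reductionCoins Gen V Sim kP).eval (ofBits x).size =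
      (simCoins Gen).eval n + M ∧
      (kP * (trials kP * blockLen Gen V Sim) + blockLen Gen V Sim).eval n ≤ M := by
    have h1 : (reductionCoins Gen V Sim kP).eval n ≤
        (reductionCoins Gen V Sim kP).eval (ofBits x).size :=
      eval_mono _ (by rw [size_ofBits]; omega)
    conv_lhs at h1 => rw [reductionCoins, Polynomial.eval_add]
    refine ⟨(reductionCoins Gen V Sim kP).eval (ofBits x).size - (simCoins Gen).eval n, ?_, ?_⟩
    · omega
    · omega
  have key : ((uniformBits (R.coins.eval (ofBits x).size)).bind fun ρ =>
      (R.code.exec A.distBits (R.time.eval (Data.pair (ofBits x) (ofBits ρ)).size)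
        (Data.pair (ofBits x) (ofBits ρ))).map
          fun o => decide (o.map Prod.fst = some (bit true))) =
      (crs Gen n).bind fun r => (found Gen V Sim kP A x r).bind fun b => verdict V x r b.1 := by
    have e : ∀ ρ : List Bool, ((R.code.exec A.distBits
        (R.time.eval (Data.pair (ofBits x) (ofBits ρ)).size)
        (Data.pair (ofBits x) (ofBits ρ))).map
          fun o => decide (o.map Prod.fst = some (bit true))) =
        (iid ((answers Gen Sim A x (crsOf Gen n (ρ.take ((simCoins Gen).eval n)))).map (List.take
          (enc ((simCoins Sim).eval n, x, crsOf Gen n (ρ.take ((simCoins Gen).eval n)),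
            ρ.drop ((simCoins Gen).eval n))).size)) (kP.eval n)).map fun zs =>
          check Gen V Sim kP x (crsOf Gen n (ρ.take ((simCoins Gen).eval n))) zs
            (ρ.drop ((simCoins Gen).eval n)) := by
      intro ρ
      have h1 := congrArg (PMF.map fun d => decide (d = some (bit true)))
        (h A.distBits (Data.pair (ofBits x) (ofBits ρ)))
      rw [PMF.map_comp, PMF.map_comp] at h1
      refine h1.trans ?_
      have e1 : prepare Gen Sim kP (Data.pair (ofBits x) (ofBits ρ)) = (kP.eval n,
          .pair (ofBits x) (ofBits (padCrs Gen Sim x (crsOf Gen n (ρ.take ((simCoins Gen).eval n))))),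
          enc ((simCoins Sim).eval n, x, crsOf Gen n (ρ.take ((simCoins Gen).eval n)),
            ρ.drop ((simCoins Gen).eval n))) := by
        simp only [prepare, Data.fst, Data.snd, toBits_ofBits, hn]
      rw [e1]
      refine congrArg₂ PMF.map (funext fun zs => ?_) rfl
      have e2 : ∀ l : List Bool, toBits (encList l) = l := fun l => by
        exact (congrArg toBits (enc_bits l)).trans (toBits_ofBits l)
      simp only [Function.comp_def, finish, Enc.enc, Data.fst, Data.snd, Option.some.injEq,
        bit.injEq, Bool.decide_eq_true]
      rw [e2, e2, e2]
    simp only [e, hR, hM.1]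
    have h1 := congrArg (fun μ => μ.bind fun p : List Bool × List Bool =>
      (iid ((answers Gen Sim A x p.1).map (List.take
        (enc ((simCoins Sim).eval n, x, p.1, p.2)).size)) (kP.eval n)).map fun zs =>
          check Gen V Sim kP x p.1 zs p.2) (Samples.of_take
        (le_refl ((simCoins Gen).eval n)) (crsOf Gen n) M)
    simp only [PMF.bind_map, PMF.bind_bind, Function.comp_def] at h1
    refine h1.trans ?_
    rw [crs_eq, PMF.bind_map]
    refine pmf_bind_congr _ fun ρ hρ => ?_
    have hr : (crsOf Gen n ρ).length ≤ (lenBound Gen Sim).eval x.length :=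
      length_crsOf_le Gen Sim n ρ (length_of_mem_uniformBits hρ).le
    simp only [Function.comp_def]
    generalize crsOf Gen n ρ = r at hr
    have h2 : ∀ ρ' : List Bool, (iid ((answers Gen Sim A x r).map (List.take
        (enc ((simCoins Sim).eval n, x, r, ρ')).size)) (kP.eval n)).map (fun zs =>
          check Gen V Sim kP x r zs ρ') = (iid (answers Gen Sim A x r) (kP.eval n)).bind fun zs =>
            PMF.pure (check Gen V Sim kP x r zs ρ') := by
      intro ρ'
      rw [iid_map, PMF.map_comp, PMF.map]
      refine congrArg (PMF.bind _) (funext fun zs => congrArg PMF.pure ?_)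
      -- Answers are cut at the size of the saved data. The unary number `simCoins` was put there to
      -- make this size large enough.
      have h3 : (simCoins Sim).eval x.length ≤ (enc ((simCoins Sim).eval n, x, r, ρ')).size := by
        have h4 : sz ((simCoins Sim).eval n, x, r, ρ') =
          (enc ((simCoins Sim).eval n, x, r, ρ')).size := rfl
        rw [sz_pair, sz_nat] at h4
        rw [← hn]
        omega
      simp only [Function.comp_def, check]
      rw [runBest_map _ _ _ _ _ _ _ fun z => simProof_take Sim x z h3]
    simp only [h2]
    -- Once truncation is removed, the answers no longer depend on the remaining coins, so these may
    -- be drawn after the answers.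
    rw [PMF.bind_comm, found, selection, PMF.bind_bind]
    refine pmf_bind_congr _ fun zs hzs => ?_
    exact check_dist Gen V Sim kP hr (length_of_mem_iid hzs) hM.2
  rw [OraclePPT.acceptProb, key, successProb, ← ex_ind_eq, ex_bind]
  refine congrArg ENNReal.toReal (ex_congr _ fun r _ => ?_)
  rw [ex_ind_eq, ← ex_ind_eq, ex_bind]
  simp only [ex_ind_eq]

end Reduction

/-! ### Analysis of completeness by comparison -/

section Analysis

variable (Gen V Sim : PPT) (kP : Polynomial ℕ) (A : PPT)

/-- The probability that `π` beats the proof that is found with the help of `A`. -/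
noncomputable def advantage (x r π : List Bool) : ℝ≥0∞ :=
  beats (verdict V x r) (simProof Sim x) ((trials kP).eval x.length) (answers Gen Sim A x r)
    (kP.eval x.length) π

theorem beats_le_one (vd : List Bool → PMF Bool) (prf : List Bool → List Bool) (m : ℕ)
    (inv : PMF (List Bool)) (k : ℕ) (π : List Bool) : beats vd prf m inv k π ≤ 1 :=
  ex_le_one _ fun _ => ex_le_one _ fun _ => ind_le_one _

/-- An honest proof is accepted at most as often as the one found with the help of `A`, up to the
probability that it beats the latter. -/
theorem accept_le_successProb (x : List Bool) (S : List Bool → PMF (List Bool)) :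
    ex (crs Gen x.length) (fun r => ex (S r) fun π => verdict V x r π true) ≤
      successProb Gen V Sim kP A x + (kP.eval x.length + 1 : ℝ≥0∞)⁻¹ +
        ex (transcript Gen x.length S) fun t => advantage Gen V Sim kP A x t.1 t.2 := by
  -- The choice `s = (k + 1) ^ 2` gives `k / s ≤ 1 / (k + 1)`.
  have hk : ((kP.eval x.length : ℕ) : ℝ≥0∞) / (((kP.eval x.length + 1) ^ 2 : ℕ) : ℝ≥0∞) ≤
      (kP.eval x.length + 1 : ℝ≥0∞)⁻¹ := by
    have h0 : (kP.eval x.length + 1 : ℝ≥0∞) ≠ 0 := by simp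
    have ht : (kP.eval x.length + 1 : ℝ≥0∞) ≠ ⊤ := by finiteness
    push_cast
    rw [pow_two, ENNReal.div_eq_inv_mul, ENNReal.mul_inv (.inl h0) (.inl ht), mul_assoc]
    refine mul_le_of_le_one_right zero_le ?_
    rw [← ENNReal.div_eq_inv_mul]
    exact ENNReal.div_le_of_le_mul (by simp)
  rw [transcript, ex_bind, successProb, ← ex_const (crs Gen x.length)
    (kP.eval x.length + 1 : ℝ≥0∞)⁻¹, ← ex_add, ← ex_add]
  refine ex_mono _ fun r _ => ?_
  rw [ex_map, ← ex_const (S r) (ex (found Gen V Sim kP A x r) _),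
    ← ex_const (S r) (kP.eval x.length + 1 : ℝ≥0∞)⁻¹, ← ex_add, ← ex_add]
  refine ex_mono _ fun π _ => ?_
  have := accept_le_selection (verdict V x r) (simProof Sim x) (answers Gen Sim A x r)
    (kP.eval x.length) (s := (kP.eval x.length + 1) ^ 2) (by positivity) π
  rw [found, advantage, eval_trials]
  exact this.trans (by gcongr)

/-- A simulated proof rarely beats the one that is found with the help of `A`, if `A` inverts. -/
theorem advantage_sim_le {F : FunFamily} (hF : F.inLen = simCoins Sim)
    (hf : F.f = fun x z => padCrs Gen Sim x (simCrs Sim x z)) (x : List Bool) {δ : ℝ}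
    (hA : DistInverts A F x δ) :
    ex (Sim.distPair (ofBits x)) (fun t => advantage Gen V Sim kP A x t.1 t.2) ≤
      (kP.eval x.length + 1 : ℝ≥0∞)⁻¹ + ENNReal.ofReal δ := by
  classical
  have hc : Sim.coins.eval (ofBits x).size = (simCoins Sim).eval x.length := by
    simp [simCoins, size_ofBits]
  set N := (lenBound Gen Sim).eval x.length with hN
  -- The test for the statistical distance sees only the padded string, and recovers the reference
  -- string from it. It need not be computable, since the statistical distance bounds every test.
  obtain ⟨unpad, hunpad⟩ : ∃ u : List Bool → List Bool, ∀ r : List Bool, r.length ≤ N →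
      u (padCrs Gen Sim x r) = r := by
    refine ⟨fun y => if h : ∃ r : List Bool, r.length ≤ N ∧ padCrs Gen Sim x r = y then h.choose
      else [], fun r hr => ?_⟩
    have h : ∃ r' : List Bool, r'.length ≤ N ∧ padCrs Gen Sim x r' = padCrs Gen Sim x r :=
      ⟨r, hr, rfl⟩
    beta_reduce
    rw [dif_pos h]
    exact pad_inj h.choose_spec.1 hr h.choose_spec.2
  have h1 : Sim.distPair (ofBits x) = (uniformBits ((simCoins Sim).eval x.length)).map
      fun z => (simCrs Sim x z, simProof Sim x z) := by
    rw [PPT.distPair, PPT.dist_eq, PMF.map_comp, hc, PMF.map, PMF.map]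
    refine pmf_bind_congr _ fun z hz => ?_
    simp only [Function.comp_def, simCrs, simProof, simOut]
    rw [List.take_of_length_le (length_of_mem_uniformBits hz).le]
  have h2 := ex_le_add_statDist ((uniformBits (F.inLen.eval x.length)).map fun z => (z, F.f x z))
    ((uniformBits (F.inLen.eval x.length)).bind fun z =>
      (A.distBits (Data.pair (ofBits x) (ofBits (F.f x z)))).map fun z' => (z', F.f x z))
    (fun p => advantage Gen V Sim kP A x (unpad p.2) (simProof Sim x p.1))
    (fun p => beats_le_one _ _ _ _ _ _)
  rw [ex_map, ex_bind, hF, hf] at h2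
  simp only [ex_map, hunpad _ (length_simCrs_le Gen Sim x _)] at h2
  rw [h1, ex_map]
  refine h2.trans (add_le_add ?_ (ENNReal.ofReal_le_ofReal ?_))
  -- After the exchange the proof itself comes from an answer of `A` to the same query, so for each
  -- `r` it is one more independent candidate and `ex_beats_le` applies.
  · rw [← ex_const (uniformBits ((simCoins Sim).eval x.length))
      (kP.eval x.length + 1 : ℝ≥0∞)⁻¹]
    exact ex_mono _ fun z _ => ex_beats_le (verdict V x _) (simProof Sim x) _
      (answers Gen Sim A x _) _
  · have := hA
    rw [DistInverts, hF, hf] at this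
    exact this

theorem length_of_mem_distPair {x : List Bool} {t : List Bool × List Bool}
    (h : t ∈ (Sim.distPair (ofBits x)).support) :
    t.1.length ≤ (lenBound Gen Sim).eval x.length := by
  have hc : Sim.coins.eval (ofBits x).size = (simCoins Sim).eval x.length := by
    simp [simCoins, size_ofBits]
  rw [PPT.distPair, PPT.dist_eq, PMF.map_comp, PMF.support_map, hc] at h
  obtain ⟨z, hz, rfl⟩ := h
  have := length_simCrs_le Gen Sim x z
  rw [simCrs, simOut, List.take_of_length_le (length_of_mem_uniformBits hz).le] at this
  exact this

/-- The comparison distinguisher. -/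
theorem exists_distinguisher (advice : ℕ → List Bool) (hadv : ∀ n, (advice n).length ≤ n) :
    ∃ D : Distinguisher, ∀ n, (advice n).length = n → ∀ X : PMF (List Bool × List Bool),
      (∀ t ∈ X.support, t.1.length ≤ (lenBound Gen Sim).eval n) →
      D.prob n X = (ex X fun t => advantage Gen V Sim kP A (advice n) t.1 t.2).toReal := by
  obtain ⟨M, hM⟩ := exists_comparison Gen V Sim kP A
  refine ⟨⟨M, advice, .X, fun n => by simpa using hadv n⟩, fun n hn X hX => ?_⟩
  rw [Distinguisher.prob, ← ex_ind_eq, ex_bind]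
  refine congrArg ENNReal.toReal (ex_congr _ fun t ht => ?_)
  rw [ex_ind_eq]
  exact hM _ _ _ (by rw [hn]; exact hX t ht)

end Analysis

/-- The number of candidates must be a polynomial with natural coefficients dominating `p`;
coefficients are rounded up, and negative ones become zero. -/
theorem exists_nat_polynomial_ge (p : Polynomial ℝ) :
    ∃ q : Polynomial ℕ, ∀ n : ℕ, p.eval (n : ℝ) ≤ q.eval n := by
  induction p using Polynomial.induction_on' with
  | add p q hp hq =>
    obtain ⟨a, ha⟩ := hp
    obtain ⟨b, hb⟩ := hq
    exact ⟨a + b, fun n => by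
      rw [Polynomial.eval_add, Polynomial.eval_add]
      push_cast
      exact add_le_add (ha n) (hb n)⟩
  | monomial k c =>
    refine ⟨.monomial k ⌈c⌉₊, fun n => ?_⟩
    simp only [Polynomial.eval_monomial]
    push_cast
    gcongr
    exact Nat.le_ceil c

/-- The statement for a common form of proofs and arguments, without a negligible loss. -/
theorem exists_reduction_of_compSound (εc εs εz : ℕ → ℝ)
    (L : Set (List Bool)) (Rel : List Bool → List Bool → Prop) (hL : ∀ x, x ∈ L ↔ ∃ w, Rel x w)
    (Gen V : PPT) (P : Prover) (hc : Complete Rel εc Gen V P) (hs : CompSound L εs Gen V)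
    (hz : ZeroKnowledge Rel εz Gen P)
    (p : Polynomial ℝ) (hp : ∀ᶠ n : ℕ in atTop, 0 < p.eval (n : ℝ)) :
    ∃ (R : OraclePPT) (F : FunFamily), ∀ A : PPT, ∀ᶠ n : ℕ in atTop, ∀ x : List Bool, x.length = n →
        (x ∈ L → DistInverts A F x (1 / p.eval (n : ℝ)) →
          1 - εc n - εz n - 3 / p.eval (n : ℝ) ≤ R.acceptProb A.distBits (ofBits x)) ∧
        (x ∉ L → R.acceptProb A.distBits (ofBits x) ≤ εs n) := by
  classical
  obtain ⟨Sim, hSim⟩ := hz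
  obtain ⟨kP, hkP⟩ := exists_nat_polynomial_ge p
  obtain ⟨R, hR⟩ := exists_reduction Gen V Sim kP
  obtain ⟨F, hF, hf⟩ := exists_funFamily Gen Sim
  refine ⟨R, F, fun A => ?_⟩
  obtain ⟨S, hS⟩ := exists_cheat Gen V Sim kP A
  -- The inputs on which the completeness bound fails. The advice is such an input whenever there is
  -- one, so a single non-uniform distinguisher excludes failures at all large lengths.
  set Bad : ℕ → List Bool → Prop := fun n x => x.length = n ∧ x ∈ L ∧
    DistInverts A F x (1 / p.eval (n : ℝ)) ∧
    ¬ (1 - εc n - εz n - 3 / p.eval (n : ℝ) ≤ R.acceptProb A.distBits (ofBits x)) with hBad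
  set advice : ℕ → List Bool := fun n => if h : ∃ x, Bad n x then h.choose else [] with hadvice
  have hadv : ∀ n, (∃ x, Bad n x) → Bad n (advice n) := fun n h => by
    simp only [hadvice, dif_pos h]
    exact h.choose_spec
  obtain ⟨D, hD⟩ := exists_distinguisher Gen V Sim kP A advice fun n => by
    by_cases h : ∃ x, Bad n x
    · exact (hadv n h).1.le
    · simp [hadvice, dif_neg h]
  filter_upwards [hp, hs S, hSim D] with n hpn hsn hDn
  have sound : ∀ x, x.length = n → x ∉ L → R.acceptProb A.distBits (ofBits x) ≤ εs n := by
    rintro x rfl hx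
    -- The reduction and the verifier facing the prover `S` accept with equal probability, so
    -- nothing is lost.
    refine le_trans (le_of_eq ?_) (hsn x rfl hx)
    rw [hR, acceptProb_eq, successProb]
    refine congrArg ENNReal.toReal (ex_congr _ fun r hr => ?_)
    rw [hS x r (length_of_mem_crs Gen Sim hr), ex_map]
  refine fun x hx => ⟨fun hxL hA => ?_, sound x hx⟩
  by_contra hbad
  -- A failure at `x` makes the advice a failure as well, and `D` carries out the comparison for the
  -- advice only.
  have hB := hadv n ⟨x, hx, hxL, hA, hbad⟩
  clear hx hxL hA hbad x
  generalize hxe : advice n = x at hB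
  obtain ⟨hx, hxL, hA, hbad⟩ := hB
  obtain ⟨w, hw⟩ := (hL x).1 hxL
  have h1 := hDn x w hx hw
  have hlen : (advice n).length = n := hxe ▸ hx
  rw [hD n hlen _ fun t ht => hx ▸ length_of_mem_distPair Gen Sim ht,
    hD n hlen _ fun t ht => ?_, hxe] at h1
  swap
  · rw [transcript, PMF.mem_support_bind_iff] at ht
    obtain ⟨r, hr, ht⟩ := ht
    rw [PMF.support_map] at ht
    obtain ⟨π, -, rfl⟩ := ht
    exact length_of_mem_crs Gen Sim hr
  subst hx
  have h2 := accept_le_successProb Gen V Sim kP A x (P x w)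
  have h3 := advantage_sim_le Gen V Sim kP A hF hf x hA
  have h4 := hc x w hw
  rw [acceptProb_eq] at h4
  rw [hR] at hbad
  -- With `k ≥ p(n)`, the selection bias and the comparison each cost at most `1 / p`; the third `1
  -- / p` is the deviation of the inverter.
  have hk : ((kP.eval x.length + 1 : ENNReal)⁻¹).toReal ≤ 1 / p.eval (x.length : ℝ) := by
    rw [ENNReal.toReal_inv, ENNReal.toReal_add (by simp) (by simp), ENNReal.toReal_natCast,
      ENNReal.toReal_one, ← one_div]
    exact one_div_le_one_div_of_le hpn ((hkP _).trans (by simp))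
  have t1 : successProb Gen V Sim kP A x ≤ 1 :=
    ex_le_one _ fun r => ex_le_one _ fun b => PMF.coe_le_one _ _
  have t2 : ∀ X : PMF (List Bool × List Bool),
      (ex X fun t => advantage Gen V Sim kP A x t.1 t.2) ≠ ⊤ := fun X =>
    ne_top_of_le_ne_top ENNReal.one_ne_top (ex_le_one _ fun t => beats_le_one _ _ _ _ _ _)
  have t3 : (kP.eval x.length + 1 : ENNReal)⁻¹ ≠ ⊤ := by simp
  have t4 := ne_top_of_le_ne_top ENNReal.one_ne_top t1
  have h5 := ENNReal.toReal_mono (by simp [t2, t4]) h2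
  rw [ENNReal.toReal_add (by simp [t4]) (t2 _), ENNReal.toReal_add t4 t3] at h5
  have h6 := ENNReal.toReal_mono (by simp) h3
  rw [ENNReal.toReal_add t3 (by simp), ENNReal.toReal_ofReal (by positivity)] at h6
  -- The direction needed: an honest proof beats the selection at most `εz` more often than a
  -- simulated one.
  have h7 := neg_abs_le ((ex (Sim.distPair (ofBits x)) fun t =>
    advantage Gen V Sim kP A x t.1 t.2).toReal -
      (ex (transcript Gen x.length (P x w)) fun t => advantage Gen V Sim kP A x t.1 t.2).toReal)
  have h8 : 3 / p.eval (x.length : ℝ) = 3 * (1 / p.eval (x.length : ℝ)) := by ring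
  rw [h8] at hbad
  linarith

end NIZK

theorem lemmaA1 (εc εs εz : ℕ → ℝ)
    (hεc : ∀ n, εc n ∈ Set.Icc (0 : ℝ) 1) (hεs : ∀ n, εs n ∈ Set.Icc (0 : ℝ) 1)
    (hεz : ∀ n, εz n ∈ Set.Icc (0 : ℝ) 1)
    (L : Set (List Bool)) (Rel : List Bool → List Bool → Prop) (hL : NIZK.IsNPRelation L Rel)
    (hNIZK : NIZK.HasNIZKProof L Rel εc εs εz ∨ NIZK.HasNIZKArgument L Rel εc εs εz)
    (p : Polynomial ℝ) (hp : ∀ᶠ n : ℕ in atTop, 0 < p.eval (n : ℝ)) :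
    ∃ (R : NIZK.OraclePPT) (F : NIZK.FunFamily), ∀ A : NIZK.PPT,
      ∃ ν : ℕ → ℝ, NIZK.Negligible ν ∧ ∀ᶠ n : ℕ in atTop, ∀ x : List Bool, x.length = n →
        (x ∈ L → NIZK.DistInverts A F x (1 / p.eval (n : ℝ)) →
          1 - εc n - εz n - 3 / p.eval (n : ℝ) - ν n
            ≤ R.acceptProb A.distBits (NIZK.Data.ofBits x)) ∧
        (x ∉ L → R.acceptProb A.distBits (NIZK.Data.ofBits x) ≤ εs n) := by
  obtain ⟨Gen, V, P, hc, hs, hz⟩ : ∃ (Gen V : NIZK.PPT) (P : NIZK.Prover),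
      NIZK.Complete Rel εc Gen V P ∧ NIZK.CompSound L εs Gen V ∧
        NIZK.ZeroKnowledge Rel εz Gen P := by
    rcases hNIZK with ⟨Gen, V, P, hc, hs, hz⟩ | ⟨Gen, V, P, hc, hs, hz⟩
    -- Only PPT cheating provers are used, so a proof system is treated as an argument whose honest
    -- prover may be unbounded.
    · exact ⟨Gen, V, P, hc, fun S => .of_forall fun n x hx hxL => hx ▸ hs x hxL _, hz⟩
    · exact ⟨Gen, V, P.prover, hc, hs, hz⟩
  obtain ⟨R, F, h⟩ := NIZK.exists_reduction_of_compSound εc εs εz L Rel hL.2.2 Gen V P hc hs hz p hp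
  -- All distributions are sampled exactly, so there is no negligible loss.
  refine ⟨R, F, fun A => ⟨fun _ => 0, Asymptotics.superpolynomialDecay_zero _ _, ?_⟩⟩
  simpa using h A
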